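/- Let $\mathbb{F}_q$ be a finite field of characteristic $p$, let $f \in \mathbb{F}_q[x_1,\dots,x_n]$ be a polynomial of total degree $d$, and let $g \in \mathbb{F}_q[x_1,\dots,x_n]$ be a factor of $f$ of exact multiplicity $p^\ell e$, where $\ell \ge 0$ and $\gcd(p,e)=1$; that is, $f = g^{p^\ell e}\, h$ where $g$ and $h$ have no common non-constant factor. (For irreducible $g$ and $f \neq 0$ this says that $g^{p^\ell e}$ is the largest power of $g$ that divides $f$.) An algebraic circuit is a finite directed acyclic graph (parallel wires allowed) whose leaves are labelled by variables or field constants, whose internal nodes are $+$ and $\times$ gates of unbounded fan-in, and whose wires carry field constants by which the value passing along them is multiplied. Its size is the number of wires, its depth is the length of the longest path from the output gate to a leaf, and it is a formula if every node feeds at most one wire. Then there is an absolute constant $c$ (independent of $q$, $p$, $\ell$, $e$, $n$, $f$, $g$) such that the following hold. 1. If $f$ is computed by an algebraic circuit of size $s$ and depth $\Delta$ over $\mathbb{F}_q$, then $g^{p^\ell}$ is computed by an algebraic circuit over the algebraic closure $\overline{\mathbb{F}_q}$ of size at most $c\,(s+d+n+1)^c = \mathrm{poly}(s,d,n)$ and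 depth at most $\Delta + c = \Delta + O(1)$. 2. If $f$ is computed by an algebraic formula of size $s$ over $\mathbb{F}_q$, then $g^{p^\ell}$ is computed by an algebraic formula over $\overline{\mathbb{F}_q}$ of size at most $c\,(s+d+n+1)^c = \mathrm{poly}(s,d,n)$. (Here the zero polynomial is given total degree $0$.) -/

import Mathlib

open MvPolynomial

universe u v

/-- A gate of an algebraic circuit over `K` with input variables `σ` and set of nodes `V`: a leaf
labelled by a variable or by a field constant, or an internal `+` or `×` gate of arbitrary fan-in
`k`, whose `j`-th incoming wire comes from the node `u j` and carries the field constant `a j`.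
A node may feed several wires of the same gate. -/
inductive Gate (K : Type u) (σ : Type v) (V : Type) : Type (max u v)
  | var (i : σ) : Gate K σ V
  | const (c : K) : Gate K σ V
  | add {k : ℕ} (a : Fin k → K) (u : Fin k → V) : Gate K σ V
  | mul {k : ℕ} (a : Fin k → K) (u : Fin k → V) : Gate K σ V

namespace Gate

/-- The number of wires that enter a gate. -/
def fanIn {K : Type u} {σ : Type v} {V : Type} : Gate K σ V → ℕ
  | var _ => 0
  | const _ => 0
  | add (k := k) _ _ => k
  | mul (k := k) _ _ => k

/-- The node at which the `j`-th wire entering a gate starts. -/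
def child {K : Type u} {σ : Type v} {V : Type} : (G : Gate K σ V) → Fin G.fanIn → V
  | var _ => Fin.elim0
  | const _ => Fin.elim0
  | add _ u => u
  | mul _ u => u

/-- The polynomial computed at a gate, when the nodes below it compute the polynomials `r j`. -/
noncomputable def value {K : Type u} {σ : Type v} {V : Type} [Field K] :
    (G : Gate K σ V) → (Fin G.fanIn → MvPolynomial σ K) → MvPolynomial σ K
  | var i => fun _ => X i
  | const c => fun _ => C c
  | add a _ => fun r => ∑ j, C (a j) * r j
  | mul a _ => fun r => ∏ j, C (a j) * r j

end Gate

/-- An algebraic circuit over `K` in the variables `σ`: a finite directed acyclic multigraph, whose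
nodes are gates, with a designated output node `root`. As there are finitely many nodes,
well-foundedness of the relation "`x` feeds a wire of `y`" says that there is no directed cycle. -/
structure AlgCircuit (K : Type u) (σ : Type v) where
  Node : Type
  [fintypeNode : Fintype Node]
  gate : Node → Gate K σ Node
  acyclic : WellFounded fun x y : Node => ∃ j, (gate y).child j = x
  root : Node

attribute [instance] AlgCircuit.fintypeNode

namespace AlgCircuit

/-- The polynomial computed at a node. -/
noncomputable def val {K : Type u} {σ : Type v} [Field K] (A : AlgCircuit K σ) :
    A.Node → MvPolynomial σ K :=
  A.acyclic.fix fun x rec => (A.gate x).value fun j => rec ((A.gate x).child j) ⟨j, rfl⟩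

theorem val_eq {K : Type u} {σ : Type v} [Field K] (A : AlgCircuit K σ) (x : A.Node) :
    A.val x = (A.gate x).value fun j => A.val ((A.gate x).child j) :=
  A.acyclic.fix_eq _ x

/-- The length of the longest directed path from a node down to a leaf. -/
noncomputable def height {K : Type u} {σ : Type v} (A : AlgCircuit K σ) : A.Node → ℕ :=
  A.acyclic.fix fun x rec =>
    Finset.univ.sup fun j => rec ((A.gate x).child j) ⟨j, rfl⟩ + 1

theorem height_eq {K : Type u} {σ : Type v} (A : AlgCircuit K σ) (x : A.Node) :
    A.height x = Finset.univ.sup fun j => A.height ((A.gate x).child j) + 1 :=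
  A.acyclic.fix_eq _ x

/-- The circuit computes the polynomial `f` at its output node. -/
def Computes {K : Type u} {σ : Type v} [Field K] (A : AlgCircuit K σ) (f : MvPolynomial σ K) :
    Prop :=
  A.val A.root = f

/-- The size of a circuit is its number of wires. -/
def size {K : Type u} {σ : Type v} (A : AlgCircuit K σ) : ℕ :=
  ∑ x, (A.gate x).fanIn

/-- The depth of a circuit is the length of the longest path from the root to a leaf. -/
noncomputable def depth {K : Type u} {σ : Type v} (A : AlgCircuit K σ) : ℕ :=
  A.height A.root

/-- A formula is a circuit in which every node feeds at most one wire: distinct wires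
`(x, j)`, the `j`-th wire entering `x`, start at distinct nodes. -/
def IsFormula {K : Type u} {σ : Type v} (A : AlgCircuit K σ) : Prop :=
  Function.Injective fun w : (x : A.Node) × Fin (A.gate x).fanIn => (A.gate w.1).child w.2

end AlgCircuit

/-- `g` is a factor of `f` with (exact) multiplicity `m`: `f = g ^ m * h`, where `g` and `h` have no
common factor other than units. For irreducible `g` this says that `m` is the exponent of the
largest power of `g` that divides `f`. -/
def HasMultiplicity {R : Type u} [CommRing R] (g f : R) (m : ℕ) : Prop :=
  ∃ h, f = g ^ m * h ∧ IsRelPrime g h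

theorem hasMultiplicity_iff_of_irreducible {R : Type u} [CommRing R] [IsDomain R] {g f : R}
    (hg : Irreducible g) (m : ℕ) : HasMultiplicity g f m ↔ g ^ m ∣ f ∧ ¬ g ^ (m + 1) ∣ f := by
  have h0 : g ^ m ≠ 0 := pow_ne_zero _ hg.ne_zero
  constructor
  · rintro ⟨h, rfl, hr⟩
    refine ⟨Dvd.intro _ rfl, fun hd => hg.not_isUnit (hr dvd_rfl ?_)⟩
    rw [pow_succ] at hd
    exact (mul_dvd_mul_iff_left h0).1 hd
  · rintro ⟨⟨h, rfl⟩, hn⟩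
    refine ⟨h, rfl, (hg.isRelPrime_iff_not_dvd).2 fun hd => hn ?_⟩
    rw [pow_succ]
    exact mul_dvd_mul_left _ hd

/-! Work over the algebraic closure K, with d the degree of f. Iterative root lifting would cost
depth, so powers of roots are instead written in closed form as residues. Let w be an irreducible
factor of f and β a simple root of w on a generic line x + aT. If y agrees with x modulo a nilpotent
t, then β lifts to a root φ of w on y + aT. Let w have multiplicity q e' in f, with q a power of p
and p not dividing e'. After translating β to 0, f on the line is F = (X^q - s^q)^e' U with s = φ -
β and U(0) a unit. The Hasse derivatives of X^q - s^q of order strictly between 0 and q vanish, so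
D_q F / F = e' / (X^q - s^q) + D_q U / U. Hence X^(2q-1) D_q F / F has residue e' s^q, and e' is
invertible. Only the q-th power of a root is reached, which is why the theorem speaks of g^(p^l).

Let F₀ be F at t = 0 and E = F₀ - F. If t^(d+1) = 0, then 1/F is the finite sum of E^j / F₀^(j+1).
Each residue is linear in the coefficients of D_q F · E^j, with constants in K, hence by
interpolation linear in values. So φ^q is a polynomial-size expression of constant depth in values
of f on the line (`exists_residue_functional`, `coeff_hasseDeriv_mul_inverse`,
`exists_rootData_line`).

For generic x and a, the irreducible factors keep their degrees on the line and their product is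
separable (`exists_generic_line`). Then w(y) is a constant times the product of its lifted roots
(`line_eq_prod`), so g^(p^l) is a product of such expressions (`exists_root_product`). Put y = x +
t(X - x). The identity holds modulo t^(d+1) and g^(p^l)(y) has degree at most d in t, so
interpolation in t truncates the product and sets t = 1 (`compBy_factor`). Only values of f at
affine arguments occur. Each gets its own copy of the circuit, so formulas stay formulas. -/

namespace Gate

/-- Relabel the nodes that feed a gate. -/
def mapNode {K : Type u} {σ : Type v} {V W : Type} (φ : V → W) : Gate K σ V → Gate K σ W
  | var i => var i
  | const c => const c
  | add a x => add a (φ ∘ x)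
  | mul a x => mul a (φ ∘ x)

variable {K : Type u} {σ : Type v} {V W : Type}

theorem fanIn_mapNode (φ : V → W) (G : Gate K σ V) : (G.mapNode φ).fanIn = G.fanIn := by
  cases G <;> rfl

theorem child_mapNode (φ : V → W) (G : Gate K σ V) (j : Fin (G.mapNode φ).fanIn) :
    (G.mapNode φ).child j = φ (G.child (Fin.cast (fanIn_mapNode φ G) j)) := by
  cases G with
  | var i => exact j.elim0
  | const c => exact j.elim0
  | add a x => rfl
  | mul a x => rfl

theorem value_mapNode [Field K] (φ : V → W) (G : Gate K σ V) (r : W → MvPolynomial σ K) :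
    (G.mapNode φ).value (fun j => r ((G.mapNode φ).child j)) =
      G.value fun j => r (φ (G.child j)) := by
  cases G <;> rfl

theorem sup_mapNode (φ : V → W) (G : Gate K σ V) (r : W → ℕ) :
    (Finset.univ.sup fun j => r ((G.mapNode φ).child j) + 1) =
      Finset.univ.sup fun j => r (φ (G.child j)) + 1 := by
  cases G <;> rfl

end Gate

/-! ### Joining circuits under a new gate -/

namespace AlgCircuit

variable {K : Type u} {σ : Type v}

/-- No wire starts at the root. -/
def RootFree (A : AlgCircuit K σ) : Prop :=
  ∀ x (j : Fin (A.gate x).fanIn), (A.gate x).child j ≠ A.root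

/-- A circuit with a single node. -/
def single (G : Gate K σ Unit) (h : G.fanIn = 0) : AlgCircuit K σ where
  Node := Unit
  gate _ := G
  acyclic := ⟨fun _ => ⟨_, fun _ ⟨j, _⟩ => (Fin.cast h j).elim0⟩⟩
  root := ()

/-- The gates of `AlgCircuit.join`. -/
def joinGate {k : ℕ} (m : Bool) (a : Fin k → K) (A : Fin k → AlgCircuit K σ) :
    Option ((j : Fin k) × (A j).Node) → Gate K σ (Option ((j : Fin k) × (A j).Node))
  | none => if m then Gate.mul a fun j => some ⟨j, (A j).root⟩
      else Gate.add a fun j => some ⟨j, (A j).root⟩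
  | some x => ((A x.1).gate x.2).mapNode fun y => some ⟨x.1, y⟩

/-- The disjoint union of circuits together with a new root, which is an addition or a
multiplication gate fed by their roots. -/
def join {k : ℕ} (m : Bool) (a : Fin k → K) (A : Fin k → AlgCircuit K σ) : AlgCircuit K σ where
  Node := Option ((j : Fin k) × (A j).Node)
  gate := joinGate m a A
  acyclic := by
    have key : ∀ (j : Fin k) (x : (A j).Node),
        Acc (fun x y => ∃ i, (joinGate m a A y).child i = x) (some ⟨j, x⟩) := by
      intro j x
      induction x using (A j).acyclic.induction with
      | _ x ih =>
        refine ⟨_, ?_⟩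
        rintro _ ⟨i, rfl⟩
        exact Eq.subst (motive := Acc _) (Gate.child_mapNode _ _ i).symm (ih _ ⟨_, rfl⟩)
    refine ⟨fun y => ?_⟩
    rcases y with _ | ⟨j, x⟩
    · refine ⟨_, ?_⟩
      rintro _ ⟨i, rfl⟩
      cases m
      · exact key _ _
      · exact key _ _
    · exact key j x
  root := none

section join

variable {k : ℕ} (m : Bool) (a : Fin k → K) (A : Fin k → AlgCircuit K σ)

theorem val_join_some [Field K] (j : Fin k) (x : (A j).Node) :
    (join m a A).val (some ⟨j, x⟩) = (A j).val x := by
  induction x using (A j).acyclic.induction with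
  | _ x ih =>
    rw [val_eq (A j)]
    refine ((val_eq _ _).trans (Gate.value_mapNode _ _ _)).trans ?_
    congr 1
    funext i
    exact ih _ ⟨i, rfl⟩

theorem height_join_some (j : Fin k) (x : (A j).Node) :
    (join m a A).height (some ⟨j, x⟩) = (A j).height x := by
  induction x using (A j).acyclic.induction with
  | _ x ih =>
    rw [height_eq (A j)]
    refine ((height_eq _ _).trans (Gate.sup_mapNode _ _ _)).trans ?_
    congr 1
    funext i
    rw [ih _ ⟨i, rfl⟩]

theorem val_join_root [Field K] : (join m a A).val (join m a A).root =
    if m then ∏ j, C (a j) * (A j).val (A j).root else ∑ j, C (a j) * (A j).val (A j).root := by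
  rw [val_eq]
  cases m
  · exact Finset.sum_congr rfl fun j _ => congrArg _ (val_join_some _ _ _ _ _)
  · exact Finset.prod_congr rfl fun j _ => congrArg _ (val_join_some _ _ _ _ _)

theorem depth_join {D : ℕ} (h : ∀ j, (A j).depth ≤ D) : (join m a A).depth ≤ D + 1 := by
  rw [depth, height_eq]
  refine Finset.sup_le fun j _ => Nat.succ_le_succ ?_
  cases m
  · exact (height_join_some _ _ _ _ _).trans_le (h _)
  · exact (height_join_some _ _ _ _ _).trans_le (h _)

theorem size_join : (join m a A).size = k + ∑ j, (A j).size := by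
  have h : (join m a A).size = ∑ x : Option ((j : Fin k) × (A j).Node),
      ((join m a A).gate x).fanIn := rfl
  rw [h, Fintype.sum_option, Fintype.sum_sigma]
  congr 1
  · cases m <;> rfl
  · exact Finset.sum_congr rfl fun j _ => Finset.sum_congr rfl fun x _ => Gate.fanIn_mapNode _ _

theorem rootFree_join : (join m a A).RootFree := by
  rintro (_ | ⟨j, x⟩) i
  · cases m <;> exact Option.some_ne_none _
  · exact (Gate.child_mapNode _ _ i).trans_ne (Option.some_ne_none _)

/-- The new wires start at the roots of the operands, so these roots must not already feed a wire of
their own circuits. -/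
theorem isFormula_join (h : ∀ j, (A j).IsFormula) (h' : ∀ j, (A j).RootFree) :
    (join m a A).IsFormula := by
  rintro ⟨_ | ⟨j, x⟩, i⟩ ⟨_ | ⟨j', x'⟩, i'⟩ e
  · cases m
    · have := Option.some.inj e
      have h1 : i = i' := congrArg Sigma.fst this
      rw [h1]
    · have := Option.some.inj e
      have h1 : i = i' := congrArg Sigma.fst this
      rw [h1]
  · exfalso
    have e' := e.trans (Gate.child_mapNode _ _ i')
    have key : ∀ r : Fin k, (some ⟨r, (A r).root⟩ : Option ((j : Fin k) × (A j).Node)) ≠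
        some ⟨j', ((A j').gate x').child (Fin.cast (Gate.fanIn_mapNode _ _) i')⟩ := by
      intro r hr
      have := Option.some.inj hr
      obtain rfl : r = j' := congrArg Sigma.fst this
      exact h' _ _ _ (eq_of_heq (Sigma.mk.inj this).2).symm
    cases m <;> exact key _ e'
  · exfalso
    have e' := e.symm.trans (Gate.child_mapNode _ _ i)
    have key : ∀ r : Fin k, (some ⟨r, (A r).root⟩ : Option ((j : Fin k) × (A j).Node)) ≠
        some ⟨j, ((A j).gate x).child (Fin.cast (Gate.fanIn_mapNode _ _) i)⟩ := by
      intro r hr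
      have := Option.some.inj hr
      obtain rfl : r = j := congrArg Sigma.fst this
      exact h' _ _ _ (eq_of_heq (Sigma.mk.inj this).2).symm
    cases m <;> exact key _ e'
  · have e' := ((Gate.child_mapNode _ _ i).symm.trans e).trans (Gate.child_mapNode _ _ i')
    have := Option.some.inj e'
    obtain rfl : j = j' := congrArg Sigma.fst this
    have h2 := eq_of_heq (Sigma.mk.inj this).2
    have h3 := @h j ⟨x, Fin.cast (Gate.fanIn_mapNode _ _) i⟩
      ⟨x', Fin.cast (Gate.fanIn_mapNode _ _) i'⟩ h2
    obtain rfl : x = x' := congrArg Sigma.fst h3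
    have h4 := eq_of_heq (Sigma.mk.inj h3).2
    rw [Fin.cast_injective _ h4]

end join

end AlgCircuit

/-- `P` is computed by a circuit of size at most `s` and depth at most `D`, which is a formula if
`b` holds. -/
def CompBy {K : Type u} {σ : Type v} [Field K] (b : Prop) (s D : ℕ) (P : MvPolynomial σ K) : Prop :=
  ∃ A : AlgCircuit K σ, A.Computes P ∧ A.size ≤ s ∧ A.depth ≤ D ∧ (b → A.IsFormula ∧ A.RootFree)

/-! ### Cost of sums, products and powers -/

namespace CompBy

variable {K : Type u} {σ : Type v} [Field K] {b : Prop}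

theorem mono {s s' D D' : ℕ} {P : MvPolynomial σ K} (h : CompBy b s D P) (hs : s ≤ s')
    (hD : D ≤ D') : CompBy b s' D' P := by
  obtain ⟨A, h1, h2, h3, h4⟩ := h
  exact ⟨A, h1, h2.trans hs, h3.trans hD, h4⟩

theorem of_const (c : K) (s D : ℕ) : CompBy b s D (C c : MvPolynomial σ K) := by
  refine ⟨AlgCircuit.single (Gate.const c) rfl, ?_, ?_, ?_, fun _ => ⟨?_, ?_⟩⟩
  · rw [AlgCircuit.Computes, AlgCircuit.val_eq]; rfl
  · exact (Finset.sum_eq_zero fun _ _ => rfl).trans_le (Nat.zero_le s)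
  · rw [AlgCircuit.depth, AlgCircuit.height_eq]
    exact Finset.sup_le fun j _ => j.elim0
  · rintro ⟨_, i⟩
    exact i.elim0
  · rintro _ i
    exact i.elim0

/-- Every operand is a separate copy and nothing is shared. Sizes therefore add up, and one
construction serves circuits and formulas. -/
theorem join_fin {k : ℕ} {s D : ℕ} (m : Bool) (a : Fin k → K) {P : Fin k → MvPolynomial σ K}
    (h : ∀ j, CompBy b s D (P j)) :
    CompBy b (k * (s + 1)) (D + 1) (if m then ∏ j, C (a j) * P j else ∑ j, C (a j) * P j) := by
  choose A h1 h2 h3 h4 using h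
  refine ⟨AlgCircuit.join m a A, ?_, ?_, AlgCircuit.depth_join _ _ _ h3, fun hb =>
    ⟨AlgCircuit.isFormula_join _ _ _ (fun j => (h4 j hb).1) (fun j => (h4 j hb).2),
      AlgCircuit.rootFree_join _ _ _⟩⟩
  · rw [AlgCircuit.Computes, AlgCircuit.val_join_root]
    simp only [show ∀ j, (A j).val (A j).root = P j from h1]
  · rw [AlgCircuit.size_join]
    calc k + ∑ j, (A j).size ≤ k + ∑ _j : Fin k, s :=
          Nat.add_le_add_left (Finset.sum_le_sum fun j _ => h2 j) _
      _ = k * (s + 1) := by simp; ring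

theorem sum {ι : Type*} (t : Finset ι) {k s D : ℕ} (hk : t.card ≤ k) (a : ι → K)
    {P : ι → MvPolynomial σ K} (h : ∀ i ∈ t, CompBy b s D (P i)) :
    CompBy b (k * (s + 1)) (D + 1) (∑ i ∈ t, C (a i) * P i) := by
  have := join_fin (b := b) false (fun j => a (t.equivFin.symm j))
    (P := fun j => P (t.equivFin.symm j)) fun j => h _ (t.equivFin.symm j).2
  refine (cast (congrArg _ ?_) this).mono (Nat.mul_le_mul_right _ hk) le_rfl
  rw [if_neg Bool.false_ne_true, ← Finset.sum_coe_sort t]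
  exact t.equivFin.symm.sum_comp fun i => C (a i) * P i

theorem prod {ι : Type*} (t : Finset ι) {k s D : ℕ} (hk : t.card ≤ k)
    {P : ι → MvPolynomial σ K} (h : ∀ i ∈ t, CompBy b s D (P i)) :
    CompBy b (k * (s + 1)) (D + 1) (∏ i ∈ t, P i) := by
  have := join_fin (b := b) true (fun _ => 1)
    (P := fun j => P (t.equivFin.symm j)) fun j => h _ (t.equivFin.symm j).2
  refine (cast (congrArg _ ?_) this).mono (Nat.mul_le_mul_right _ hk) le_rfl
  rw [if_pos rfl, ← Finset.prod_coe_sort t]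
  simp only [map_one, one_mul]
  exact t.equivFin.symm.prod_comp fun i => P i

theorem pow {k j s D : ℕ} (hk : j ≤ k) {P : MvPolynomial σ K} (h : CompBy b s D P) :
    CompBy b (k * (s + 1)) (D + 1) (P ^ j) := by
  have := prod (Finset.range j) (by simpa using hk) (P := fun _ => P) fun _ _ => h
  simpa using this

theorem lin {s D : ℕ} {P Q : MvPolynomial σ K} (α β : K) (hP : CompBy b s D P)
    (hQ : CompBy b s D Q) : CompBy b (2 * (s + 1)) (D + 1) (C α * P + C β * Q) := by
  have := sum (b := b) (s := s) (D := D) (Finset.univ : Finset Bool) (k := 2) (by simp)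
    (fun i => cond i α β)
    (P := fun i => cond i P Q) (by rintro (_ | _) _ <;> assumption)
  simpa using this

theorem mul {s D : ℕ} {P Q : MvPolynomial σ K} (hP : CompBy b s D P)
    (hQ : CompBy b s D Q) : CompBy b (2 * (s + 1)) (D + 1) (P * Q) := by
  have := prod (b := b) (s := s) (D := D) (Finset.univ : Finset Bool) (k := 2) (by simp)
    (P := fun i => cond i P Q) (by rintro (_ | _) _ <;> assumption)
  simpa using this

end CompBy

/-! ### Affine substitution into a circuit -/

namespace Gate

variable {F K : Type u} {σ : Type v} {V : Type} [Field F] [Field K] [Algebra F K]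

/-- The gate that replaces the gate `G` at the node `x` when every variable `X i` is replaced by
`C (c i) + C t * X i`. -/
def affine (c : σ → K) (t : K) (x : V) : Gate F σ V → Gate K σ (V × Option Bool)
  | var i => add ![c i, t] ![(x, some false), (x, some true)]
  | const k => const (algebraMap F K k)
  | add a y => add (fun j => algebraMap F K (a j)) fun j => (y j, none)
  | mul a y => mul (fun j => algebraMap F K (a j)) fun j => (y j, none)

variable (c : σ → K) (t : K) (x : V)

theorem fanIn_affine_le (G : Gate F σ V) : (G.affine c t x).fanIn ≤ G.fanIn + 2 := by
  cases G <;> simp [affine, fanIn]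

theorem child_affine_none (G : Gate F σ V) (i : Fin (G.affine c t x).fanIn) {z : V}
    (h : (G.affine c t x).child i = (z, none)) :
    ∃ k : Fin G.fanIn, (k : ℕ) = i ∧ G.child k = z := by
  cases G with
  | var j =>
    exfalso
    change Fin 2 at i
    fin_cases i
    · exact absurd (congrArg Prod.snd h) (by simp [child, affine])
    · exact absurd (congrArg Prod.snd h) (by simp [child, affine])
  | const k => exact i.elim0
  | add a y => exact ⟨i, rfl, congrArg Prod.fst h⟩
  | mul a y => exact ⟨i, rfl, congrArg Prod.fst h⟩

theorem child_affine_some (G : Gate F σ V) (i : Fin (G.affine c t x).fanIn) {z : V} {b : Bool}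
    (h : (G.affine c t x).child i = (z, some b)) : x = z ∧ (i : ℕ) = b.toNat := by
  cases G with
  | var j =>
    change Fin 2 at i
    fin_cases i
    · have h1 : (x, some false) = (z, some b) := h
      simp at h1
      obtain ⟨h1, rfl⟩ := h1
      exact ⟨h1, rfl⟩
    · have h1 : (x, some true) = (z, some b) := h
      simp at h1
      obtain ⟨h1, rfl⟩ := h1
      exact ⟨h1, rfl⟩
  | const k => exact i.elim0
  | add a y => cases congrArg Prod.snd h
  | mul a y => cases congrArg Prod.snd h

end Gate

/-- Extension of scalars combined with the substitution of `C (c i) + C t * X i` for `X i`. -/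
noncomputable def affineHom {F K : Type u} {σ : Type v} [Field F] [Field K] [Algebra F K]
    (c : σ → K) (t : K) : MvPolynomial σ F →+* MvPolynomial σ K :=
  eval₂Hom (C.comp (algebraMap F K)) fun i => C (c i) + C t * X i

namespace AlgCircuit

variable {F K : Type u} {σ : Type v}

/-- There is a directed path from the node to the root. -/
def Reach (A : AlgCircuit F σ) : A.Node → Prop :=
  Relation.ReflTransGen (fun x y => ∃ j, (A.gate x).child j = y) A.root

-- Size counts wires, so isolated leaves are free until the substitution puts two wires under each.
-- Pruning to the nodes that lead to the root bounds this cost: such a node is the root or the start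
-- of a wire.
open scoped Classical in
theorem card_reach_le (A : AlgCircuit F σ) : (Finset.univ.filter A.Reach).card ≤ A.size + 1 := by
  have h : Finset.univ.filter A.Reach ⊆ insert A.root (Finset.univ.image
      fun w : (x : A.Node) × Fin (A.gate x).fanIn => (A.gate w.1).child w.2) := by
    intro x hx
    rcases Relation.ReflTransGen.cases_tail (Finset.mem_filter.1 hx).2 with h | ⟨y, -, j, hj⟩
    · exact Finset.mem_insert.2 (Or.inl h)
    · exact Finset.mem_insert_of_mem (Finset.mem_image.2 ⟨⟨y, j⟩, Finset.mem_univ _, hj⟩)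
  refine (Finset.card_le_card h).trans ((Finset.card_insert_le _ _).trans ?_)
  refine Nat.succ_le_succ (Finset.card_image_le.trans ?_)
  simp [size]

/-- A wire from the root into such a node would close a cycle. Thus pruning leaves no wire that
starts at the root, as joining formulas requires. -/
theorem child_ne_root_of_reach (A : AlgCircuit F σ) {x : A.Node} (h : A.Reach x) : ∀ j, (A.gate x).child j ≠ A.root := by
  intro j hj
  have h2 : Relation.TransGen (fun x y => ∃ j, (A.gate x).child j = y) A.root A.root :=
    Relation.TransGen.tail' h ⟨j, hj⟩
  have h3 : WellFounded (Relation.TransGen fun x y => ∃ j, (A.gate y).child j = x) :=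
    A.acyclic.transGen
  exact h3.irrefl.irrefl _ (Relation.transGen_swap.2 h2)

variable [Field F] [Field K] [Algebra F K]

open scoped Classical in
/-- The gates of `AlgCircuit.affine`. -/
noncomputable def affineGate (A : AlgCircuit F σ) (c : σ → K) (t : K) :
    A.Node × Option Bool → Gate K σ (A.Node × Option Bool)
  | (x, none) => if A.Reach x then (A.gate x).affine c t x else Gate.const 0
  | (_, some false) => Gate.const 1
  | (x, some true) => match A.gate x with
    | Gate.var i => Gate.var i
    | _ => Gate.const 0

variable (A : AlgCircuit F σ) (c : σ → K) (t : K)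

theorem affineGate_of_reach {x : A.Node} (h : A.Reach x) :
    A.affineGate c t (x, none) = (A.gate x).affine c t x := if_pos h

theorem affineGate_of_not_reach {x : A.Node} (h : ¬ A.Reach x) :
    A.affineGate c t (x, none) = Gate.const 0 := if_neg h

theorem reach_of_wire {x : A.Node} (i : Fin (A.affineGate c t (x, none)).fanIn) : A.Reach x := by
  by_contra h
  rw [affineGate_of_not_reach A c t h] at i
  exact i.elim0

theorem exists_wire_of_child_eq_none {x z : A.Node} (i : Fin (A.affineGate c t (x, none)).fanIn)
    (h : (A.affineGate c t (x, none)).child i = (z, none)) :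
    ∃ k : Fin (A.gate x).fanIn, (k : ℕ) = i ∧ (A.gate x).child k = z := by
  have hr := reach_of_wire A c t i
  revert i
  rw [affineGate_of_reach A c t hr]
  exact fun i h => Gate.child_affine_none c t x _ i h

theorem eq_of_child_eq_some {x z : A.Node} {b : Bool}
    (i : Fin (A.affineGate c t (x, none)).fanIn)
    (h : (A.affineGate c t (x, none)).child i = (z, some b)) : x = z ∧ (i : ℕ) = b.toNat := by
  have hr := reach_of_wire A c t i
  revert i
  rw [affineGate_of_reach A c t hr]
  exact fun i h => Gate.child_affine_some c t x _ i h

theorem fanIn_affineGate_some (x : A.Node) (b : Bool) :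
    (A.affineGate c t (x, some b)).fanIn = 0 := by
  cases b
  · rfl
  · rw [affineGate]; split <;> rfl

/-- The circuit that results from `A` by extension of scalars, the substitution of
`C (c i) + C t * X i` for `X i`, and the removal of all wires that do not lead to the root. -/
noncomputable def affine : AlgCircuit K σ where
  Node := A.Node × Option Bool
  gate := A.affineGate c t
  acyclic := by
    have leaf : ∀ (x : A.Node) (b : Bool),
        Acc (fun x y => ∃ i, (A.affineGate c t y).child i = x) (x, some b) := fun x b =>
      ⟨_, fun y ⟨i, _⟩ => (Fin.cast (fanIn_affineGate_some A c t x b) i).elim0⟩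
    refine ⟨?_⟩
    rintro ⟨x, _ | b⟩
    · induction x using A.acyclic.induction with
      | _ x ih =>
        refine ⟨_, ?_⟩
        rintro ⟨y, _ | b⟩ ⟨i, hi⟩
        · obtain ⟨k, -, hk⟩ := exists_wire_of_child_eq_none A c t i hi
          exact ih _ ⟨k, hk⟩
        · exact leaf _ _
    · exact leaf _ _
  root := (A.root, none)

theorem val_affine {x : A.Node} (h : A.Reach x) :
    (A.affine c t).val (x, none) = affineHom c t (A.val x) := by
  induction x using A.acyclic.induction with
  | _ x ih =>
    have e1 : (A.affine c t).val (x, none) = (A.affineGate c t (x, none)).value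
        fun j => (A.affine c t).val ((A.affineGate c t (x, none)).child j) := val_eq _ _
    rw [e1, affineGate_of_reach A c t h, val_eq A]
    have hr : ∀ j, A.Reach ((A.gate x).child j) := fun j => h.tail ⟨j, rfl⟩
    have ih' := fun j => ih _ ⟨j, rfl⟩ (hr j)
    have h0 : (A.affine c t).val (x, some false) = 1 :=
      (val_eq _ _).trans (map_one C)
    have h1 : ∀ i, A.gate x = Gate.var i → (A.affine c t).val (x, some true) = X i := by
      intro i hi
      have e2 : (A.affine c t).val (x, some true) = (A.affineGate c t (x, some true)).value
        fun j => (A.affine c t).val ((A.affineGate c t (x, some true)).child j) := val_eq _ _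
      have e3 : A.affineGate c t (x, some true) = Gate.var i := by rw [affineGate, hi]
      rw [e2, e3]; rfl
    clear e1 ih hr h
    cases hG : A.gate x with
    | var i =>
      have e2 : affineHom c t (X i : MvPolynomial σ F) = C (c i) + C t * X i := by simp [affineHom]
      refine Eq.trans ?_ e2.symm
      refine (Fin.sum_univ_two _).trans ?_
      change C (c i) * (A.affine c t).val (x, some false) +
        C t * (A.affine c t).val (x, some true) = _
      rw [h0, h1 i hG, mul_one]
    | const k => simp [Gate.value, Gate.affine, affineHom]
    | add a y =>
      rw [hG] at ih'
      refine Eq.trans ?_ (map_sum (affineHom c t) _ _).symm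
      refine Finset.sum_congr rfl fun j _ => ?_
      refine Eq.trans (congrArg₂ _ ?_ (ih' j)) (map_mul (affineHom c t) _ _).symm
      simp [affineHom]
    | mul a y =>
      rw [hG] at ih'
      refine Eq.trans ?_ (map_prod (affineHom c t) _ _).symm
      refine Finset.prod_congr rfl fun j _ => ?_
      refine Eq.trans (congrArg₂ _ ?_ (ih' j)) (map_mul (affineHom c t) _ _).symm
      simp [affineHom]

theorem height_affine_some (x : A.Node) (b : Bool) : (A.affine c t).height (x, some b) = 0 := by
  refine (height_eq _ _).trans (Nat.le_zero.1 (Finset.sup_le fun j _ => ?_))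
  exact (Fin.cast (fanIn_affineGate_some A c t x b) j).elim0

theorem height_affine_le (x : A.Node) : (A.affine c t).height (x, none) ≤ A.height x + 1 := by
  induction x using A.acyclic.induction with
  | _ x ih =>
    refine (height_eq _ _).trans_le (Finset.sup_le fun i _ => ?_)
    change Fin (A.affineGate c t (x, none)).fanIn at i
    change (A.affine c t).height ((A.affineGate c t (x, none)).child i) + 1 ≤ _
    rcases hz : (A.affineGate c t (x, none)).child i with ⟨z, _ | b⟩
    · obtain ⟨k, -, hk⟩ := exists_wire_of_child_eq_none A c t i hz
      refine Nat.succ_le_succ ((ih z ⟨k, hk⟩).trans ?_)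
      rw [height_eq A x, ← hk]
      exact Finset.le_sup (f := fun j => A.height ((A.gate x).child j) + 1) (Finset.mem_univ k)
    · rw [height_affine_some]
      exact Nat.succ_le_succ (Nat.zero_le _)

theorem size_affine_le : (A.affine c t).size ≤ 3 * (A.size + 1) := by
  classical
  have h : (A.affine c t).size = ∑ x : A.Node × Option Bool, (A.affineGate c t x).fanIn := rfl
  rw [h, Fintype.sum_prod_type]
  have h1 : ∀ x : A.Node, ∑ o, (A.affineGate c t (x, o)).fanIn ≤
      (A.gate x).fanIn + if A.Reach x then 2 else 0 := by
    intro x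
    rw [Fintype.sum_option, Finset.sum_eq_zero fun b _ => fanIn_affineGate_some A c t x b]
    split_ifs with hr
    · rw [affineGate_of_reach A c t hr]
      exact Gate.fanIn_affine_le _ _ _ _
    · rw [affineGate_of_not_reach A c t hr]
      exact Nat.zero_le _
  refine (Finset.sum_le_sum fun x _ => h1 x).trans ?_
  rw [Finset.sum_add_distrib, ← Finset.sum_filter, Finset.sum_const]
  have := A.card_reach_le
  change A.size + _ ≤ _
  rw [smul_eq_mul]
  lia

theorem rootFree_affine : (A.affine c t).RootFree := by
  rintro ⟨x, _ | b⟩ i hi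
  · change Fin (A.affineGate c t (x, none)).fanIn at i
    change (A.affineGate c t (x, none)).child i = (A.root, none) at hi
    have hr := reach_of_wire A c t i
    obtain ⟨k, -, hk⟩ := exists_wire_of_child_eq_none A c t i hi
    exact child_ne_root_of_reach A hr k hk
  · exact (Fin.cast (fanIn_affineGate_some A c t x b) i).elim0

theorem isFormula_affine (h : A.IsFormula) : (A.affine c t).IsFormula := by
  rintro ⟨⟨x, _ | b⟩, i⟩ ⟨⟨x', _ | b'⟩, i'⟩ e
  · change Fin (A.affineGate c t (x, none)).fanIn at i
    change Fin (A.affineGate c t (x', none)).fanIn at i'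
    change (A.affineGate c t (x, none)).child i = (A.affineGate c t (x', none)).child i' at e
    -- A new leaf carries the name of the only gate that it feeds, and the wire index tells its two
    -- leaves apart. Every other wire starts at an old node, where the formula property of `A`
    -- applies.
    have key : x = x' ∧ (i : ℕ) = i' := by
      rcases hz : (A.affineGate c t (x, none)).child i with ⟨z, _ | b⟩
      · rw [hz] at e
        replace e := e.symm
        obtain ⟨k, hik, hk⟩ := exists_wire_of_child_eq_none A c t i hz
        obtain ⟨k', hik', hk'⟩ := exists_wire_of_child_eq_none A c t i' e
        have := @h ⟨x, k⟩ ⟨x', k'⟩ (hk.trans hk'.symm)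
        obtain rfl : x = x' := congrArg Sigma.fst this
        have h2 : k = k' := eq_of_heq (Sigma.mk.inj this).2
        exact ⟨rfl, by rw [← hik, ← hik', h2]⟩
      · rw [hz] at e
        replace e := e.symm
        obtain ⟨h1, h2⟩ := eq_of_child_eq_some A c t i hz
        obtain ⟨h1', h2'⟩ := eq_of_child_eq_some A c t i' e
        exact ⟨h1.trans h1'.symm, h2.trans h2'.symm⟩
    obtain ⟨rfl, h2⟩ := key
    rw [Fin.ext h2]
  · exact (Fin.cast (fanIn_affineGate_some A c t x' b') i').elim0
  · exact (Fin.cast (fanIn_affineGate_some A c t x b) i).elim0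
  · exact (Fin.cast (fanIn_affineGate_some A c t x b) i).elim0

theorem compBy_affineHom {b : Prop} {f : MvPolynomial σ F} (hA : A.Computes f)
    (hb : b → A.IsFormula) :
    CompBy b (3 * (A.size + 1)) (A.depth + 1) (affineHom c t f) :=
  ⟨A.affine c t, (val_affine A c t Relation.ReflTransGen.refl).trans (congrArg _ hA),
    size_affine_le A c t, height_affine_le A c t A.root,
    fun h => ⟨isFormula_affine A c t (hb h), rootFree_affine A c t⟩⟩

end AlgCircuit

namespace Polynomial

/-! ### Interpolation -/

section Interpolation

/-- The conditions on `c` form a square linear system with a Vandermonde matrix, invertible because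
the nodes are distinct. -/
theorem exists_sum_mul_pow_eq {K : Type u} [Field K] (η : ℕ → K) (hη : Function.Injective η) (M : ℕ)
    (w : ℕ → K) :
    ∃ c : ℕ → K, ∀ k ≤ M, ∑ i ∈ Finset.range (M + 1), c i * η i ^ k = w k := by
  set V : Matrix (Fin (M + 1)) (Fin (M + 1)) K := Matrix.vandermonde fun i => η i with hV
  have hdet : IsUnit V.det := by
    rw [isUnit_iff_ne_zero]
    exact Matrix.det_vandermonde_ne_zero_iff.2 (hη.comp Fin.val_injective)
  let c := Matrix.vecMul (fun i : Fin (M + 1) => w i) V⁻¹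
  have hc : Matrix.vecMul c V = fun i : Fin (M + 1) => w i := by
    rw [Matrix.vecMul_vecMul, Matrix.nonsing_inv_mul _ hdet, Matrix.vecMul_one]
  refine ⟨fun i => if h : i < M + 1 then c ⟨i, h⟩ else 0, fun k hk => ?_⟩
  have := congrFun hc ⟨k, Nat.lt_succ_of_le hk⟩
  rw [← this, Finset.sum_range]
  simp only [Fin.is_lt, dite_true, Fin.eta, Matrix.vecMul, dotProduct]
  rfl

/-- A linear functional of the coefficients of a polynomial of bounded degree is a linear
functional of its values. -/
theorem exists_sum_eval_eq {K : Type u} [Field K] (η : ℕ → K) (hη : Function.Injective η) (M : ℕ)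
    (w : ℕ → K) :
    ∃ c : ℕ → K, ∀ (S : Type v) [CommRing S] [Algebra K S] (P : S[X]), P.natDegree ≤ M →
      ∑ i ∈ Finset.range (M + 1), c i • P.eval (algebraMap K S (η i)) =
        ∑ k ∈ Finset.range (M + 1), w k • P.coeff k := by
  obtain ⟨c, hc⟩ := exists_sum_mul_pow_eq η hη M w
  refine ⟨c, fun S _ _ P hP => ?_⟩
  simp only [eval_eq_sum_range' (Nat.lt_succ_of_le hP), Finset.smul_sum]
  rw [Finset.sum_comm]
  refine Finset.sum_congr rfl fun k hk => ?_
  rw [← hc k (Nat.lt_succ_iff.1 (Finset.mem_range.1 hk)), Finset.sum_smul]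
  refine Finset.sum_congr rfl fun i _ => ?_
  rw [← map_pow, mul_comm, ← Algebra.smul_def, smul_smul]

end Interpolation

/-! ### Hasse derivatives and residues -/

section Residue

open LaurentSeries

variable {S : Type u} [CommRing S]

/-- Only the two extreme terms of the Leibniz rule survive. On such `f` the operator of order `q`
acts like a derivation, which makes a logarithmic derivative possible. -/
theorem hasseDeriv_mul_of_forall_lt {q : ℕ} (hq : 0 < q) {f g : S[X]}
    (hf : ∀ i, 0 < i → i < q → hasseDeriv i f = 0) :
    hasseDeriv q (f * g) = hasseDeriv q f * g + f * hasseDeriv q g := by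
  rw [hasseDeriv_mul, Finset.sum_eq_add_of_mem (q, 0) (0, q)
    (Finset.HasAntidiagonal.mem_antidiagonal.2 (add_zero q)) (Finset.HasAntidiagonal.mem_antidiagonal.2 (zero_add q))
    (by simp [hq.ne'])]
  · simp
  · rintro ⟨i, j⟩ hij ⟨h1, h2⟩
    replace hij : i + j = q := Finset.HasAntidiagonal.mem_antidiagonal.1 hij
    have hi : 0 < i := Nat.pos_of_ne_zero fun h => h2 (by ext <;> simp <;> lia)
    have hi' : i < q := lt_of_le_of_ne (by lia) fun h => h1 (by ext <;> simp <;> lia)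
    rw [hf i hi hi', zero_mul]

theorem hasseDeriv_mul_eq_zero {i : ℕ} (hi : 0 < i) {f g : S[X]}
    (hf : ∀ k, 0 < k → k ≤ i → hasseDeriv k f = 0) (hg : hasseDeriv i g = 0) :
    hasseDeriv i (f * g) = 0 := by
  rw [hasseDeriv_mul_of_forall_lt hi fun k h h' => hf k h h'.le, hf i hi le_rfl, hg]
  simp

theorem hasseDeriv_pow_of_forall_lt {q : ℕ} (hq : 0 < q) {f : S[X]}
    (hf : ∀ i, 0 < i → i < q → hasseDeriv i f = 0) (e : ℕ) :
    (∀ i, 0 < i → i < q → hasseDeriv i (f ^ e) = 0) ∧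
      hasseDeriv q (f ^ e) = e * f ^ (e - 1) * hasseDeriv q f := by
  induction e with
  | zero => exact ⟨fun i hi _ => by rw [pow_zero, ← C_1]; exact Polynomial.hasseDeriv_C i 1 hi,
      by rw [pow_zero, ← C_1, Polynomial.hasseDeriv_C q 1 hq]; simp⟩
  | succ e ih =>
    rw [pow_succ']
    refine ⟨fun i hi hi' => hasseDeriv_mul_eq_zero hi
      (fun k h h' => hf k h (h'.trans_lt hi')) (ih.1 i hi hi'), ?_⟩
    rw [hasseDeriv_mul_of_forall_lt hq hf, ih.2]
    rcases e with _ | e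
    · simp
    · push_cast
      ring

/-- The prime p divides every binomial coefficient of p^l other than the two trivial ones. -/
theorem hasseDeriv_X_pow_sub_C {p : ℕ} (hp : p.Prime) [CharP S p] (l : ℕ) (s : S) {i : ℕ}
    (hi : 0 < i) : hasseDeriv i (X ^ p ^ l - C s : S[X]) = if i = p ^ l then 1 else 0 := by
  rw [map_sub, hasseDeriv_C _ _ hi, sub_zero, ← monomial_one_right_eq_X_pow, hasseDeriv_monomial]
  split_ifs with h
  · subst h; simp
  · have h3 : ((p ^ l).choose i : S) = 0 :=
      (CharP.cast_eq_zero_iff S p _).2 (hp.dvd_choose_pow hi.ne' h)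
    rw [h3]; simp

/-- The Laurent series of a polynomial. -/
noncomputable def laurentHom (S : Type u) [CommRing S] : S[X] →+* S⸨X⸩ :=
  (HahnSeries.ofPowerSeries ℤ S).comp coeToPowerSeries.ringHom

theorem laurentHom_apply (f : S[X]) :
    laurentHom S f = HahnSeries.ofPowerSeries ℤ S (f : PowerSeries S) := rfl

theorem laurentHom_X_pow (n : ℕ) : laurentHom S (X ^ n) = HahnSeries.single (n : ℤ) 1 := by
  rw [map_pow, laurentHom_apply, Polynomial.coe_X, HahnSeries.ofPowerSeries_X,
    HahnSeries.single_pow]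
  simp

theorem laurentHom_C (s : S) : laurentHom S (C s) = HahnSeries.single 0 s := by
  rw [laurentHom_apply, Polynomial.coe_C, HahnSeries.ofPowerSeries_C]
  rfl

theorem coeff_neg_one_ofPowerSeries (f : PowerSeries S) :
    (HahnSeries.ofPowerSeries ℤ S f).coeff (-1) = 0 := by
  rw [PowerSeries.coeff_coe, if_pos (by norm_num)]

/-- The residue of `X ^ (2 q - 1) / (X ^ q - s)` for nilpotent `s`. -/
theorem exists_inverse_X_pow_sub_C {q : ℕ} (hq : 0 < q) {s : S} (hs : IsNilpotent s) :
    ∃ Y : S⸨X⸩, laurentHom S (X ^ q - C s) * Y = 1 ∧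
      (laurentHom S (X ^ (2 * q - 1)) * Y).coeff (-1) = s := by
  obtain ⟨N, hN⟩ := hs
  -- The exponent is raised by 2 so that the geometric sum below contains the index 1, which carries
  -- the residue.
  have hN' : s ^ (N + 2) = 0 := by rw [pow_add, hN, zero_mul]
  let z : S⸨X⸩ := HahnSeries.single (-(q : ℤ)) s
  have hz : ∀ k : ℕ, z ^ k = HahnSeries.single (-(q * k : ℤ)) (s ^ k) := fun k => by
    rw [HahnSeries.single_pow]; congr 2; simp; ring
  refine ⟨HahnSeries.single (-(q : ℤ)) 1 * ∑ k ∈ Finset.range (N + 2), z ^ k, ?_, ?_⟩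
  · have : laurentHom S (X ^ q - C s) = HahnSeries.single (q : ℤ) 1 * (1 - z) := by
      rw [map_sub, laurentHom_X_pow, laurentHom_C, mul_sub, mul_one, HahnSeries.single_mul_single]
      simp
    rw [this, mul_mul_mul_comm, HahnSeries.single_mul_single, mul_neg_geom_sum, hz, hN']
    simp
  · rw [laurentHom_X_pow, ← mul_assoc, HahnSeries.single_mul_single, Finset.mul_sum,
      HahnSeries.coeff_sum]
    -- The term of index k sits in degree q - 1 - q k, which is -1 only for k = 1.
    rw [Finset.sum_eq_single 1]
    · rw [hz, HahnSeries.single_mul_single, HahnSeries.coeff_single, if_pos]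
      · simp
      · push_cast [show 1 ≤ 2 * q by lia]; ring
    · intro k _ hk
      rw [hz, HahnSeries.single_mul_single, HahnSeries.coeff_single, if_neg]
      push_cast [show 1 ≤ 2 * q by lia]
      intro h
      apply hk
      have h1 : (q : ℤ) * (1 - k) = 0 := by linarith
      rcases mul_eq_zero.1 h1 with h2 | h2 <;> lia
    · simp

/-- The residue of `X ^ (2 q - 1) F' / F`, where `F'` is the Hasse derivative of order `q = p ^ l`
of `F = (X - s) ^ (q e) U`. -/
theorem coeff_hasseDeriv_mul_inverse {p : ℕ} (hp : p.Prime) [CharP S p] (l e : ℕ) {F U : S[X]}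
    {s : S} (hs : IsNilpotent s) (hF : F = (X - C s) ^ (p ^ l * e) * U) (hU : IsUnit (U.coeff 0))
    {G : S⸨X⸩} (hG : laurentHom S F * G = 1) :
    (laurentHom S (X ^ (2 * p ^ l - 1) * hasseDeriv (p ^ l) F) * G).coeff (-1) =
      e * s ^ p ^ l := by
  have := Fact.mk hp
  set q := p ^ l with hq
  have hq0 : 0 < q := pow_pos hp.pos _
  set V : S[X] := X ^ q - C (s ^ q) with hV
  have hV1 : (X - C s) ^ q = V := by rw [hq, sub_pow_char_pow, hV, C_pow]
  rw [pow_mul, hV1] at hF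
  have hVd : ∀ i, 0 < i → hasseDeriv i V = if i = q then 1 else 0 := fun i hi =>
    hasseDeriv_X_pow_sub_C hp l _ hi
  have hVlt : ∀ i, 0 < i → i < q → hasseDeriv i V = 0 := fun i hi h => by
    rw [hVd i hi, if_neg h.ne]
  obtain ⟨h1, h2⟩ := hasseDeriv_pow_of_forall_lt hq0 hVlt e
  rw [hVd q hq0, if_pos rfl, mul_one] at h2
  obtain ⟨Y, hY, hYr⟩ := exists_inverse_X_pow_sub_C hq0 (hs.pow_of_pos hq0.ne')
  have hUu : IsUnit (U : PowerSeries S) :=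
    PowerSeries.isUnit_iff_constantCoeff.2 (by simpa using hU)
  obtain ⟨W, hW⟩ := hUu.exists_right_inv
  set W' := HahnSeries.ofPowerSeries ℤ S W
  have hW' : laurentHom S U * W' = 1 := by
    rw [laurentHom_apply, ← map_mul, hW, map_one]
  -- The logarithmic derivative of order q of V^e U is e / V + D_q U / U.
  have key : laurentHom S (hasseDeriv q F) * G =
      (e : S⸨X⸩) * Y + laurentHom S (hasseDeriv q U) * W' := by
    have e1 : laurentHom S (hasseDeriv q F) =
        laurentHom S F * ((e : S⸨X⸩) * Y + laurentHom S (hasseDeriv q U) * W') := by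
      rw [hF, hasseDeriv_mul_of_forall_lt hq0 h1, h2]
      simp only [map_add, map_mul, map_natCast, map_pow]
      have e2 : laurentHom S V ^ e * Y * (e : S⸨X⸩) = e * laurentHom S V ^ (e - 1) := by
        rcases e with _ | e
        · simp
        · rw [pow_succ, mul_assoc (laurentHom S V ^ e), hY, Nat.add_sub_cancel]; ring
      linear_combination laurentHom S U * (-e2) -
        laurentHom S V ^ e * laurentHom S (hasseDeriv q U) * hW'
    rw [e1, mul_right_comm, hG, one_mul]
  rw [map_mul, mul_assoc, key, mul_add, HahnSeries.coeff_add]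
  have e3 : laurentHom S (X ^ (2 * q - 1)) * ((e : S⸨X⸩) * Y) =
      HahnSeries.single 0 (e : S) * (laurentHom S (X ^ (2 * q - 1)) * Y) := by
    rw [← laurentHom_C, map_natCast (C : S →+* S[X]), map_natCast]
    ring
  -- The contribution of U is a power series and has no residue.
  have e4 : laurentHom S (X ^ (2 * q - 1)) * (laurentHom S (hasseDeriv q U) * W') =
      HahnSeries.ofPowerSeries ℤ S
        ((X ^ (2 * q - 1) * hasseDeriv q U : S[X]) * W) := by
    rw [map_mul, ← laurentHom_apply, map_mul, mul_assoc]
  rw [e3, e4, coeff_neg_one_ofPowerSeries, add_zero, HahnSeries.coeff_single_mul, sub_zero, hYr]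

/-- A polynomial `F` that is congruent to `X ^ m u`, `u 0 ≠ 0`, up to a nilpotent is invertible as a
Laurent series, and residues of multiples of its inverse are given by universal constants. -/
theorem exists_residue_functional {K : Type u} [Field K] {F₀ : K[X]} (h0 : F₀ ≠ 0)
    (h1 : F₀.coeff 0 = 0) (D : ℕ) :
    ∃ w : ℕ → ℕ → K, ∀ (S : Type v) [CommRing S] [Algebra K S] (F : S[X]),
      (F₀.map (algebraMap K S) - F) ^ (D + 1) = 0 →
      ∃ G : S⸨X⸩, laurentHom S F * G = 1 ∧
        ∀ (N : S[X]) (M : ℕ),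
          (∀ j ≤ D, (N * (F₀.map (algebraMap K S) - F) ^ j).natDegree ≤ M) →
          (laurentHom S N * G).coeff (-1) = ∑ j ∈ Finset.range (D + 1),
            ∑ i ∈ Finset.range (M + 1),
              w j i • (N * (F₀.map (algebraMap K S) - F) ^ j).coeff i := by
  obtain ⟨g, hg, hg'⟩ := exists_eq_pow_rootMultiplicity_mul_and_not_dvd F₀ h0 0
  -- Since F₀ vanishes at 0, m is positive and the subtraction in m (j + 1) - 1 is not truncated.
  have hm : 0 < F₀.rootMultiplicity 0 :=
    (rootMultiplicity_pos h0).2 (by rwa [IsRoot, ← coeff_zero_eq_eval_zero])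
  set m := F₀.rootMultiplicity 0
  rw [map_zero, sub_zero] at hg hg'
  rw [X_dvd_iff] at hg'
  have hgu : IsUnit (g : PowerSeries K) :=
    PowerSeries.isUnit_iff_constantCoeff.2 (by simpa using hg')
  obtain ⟨W, hW⟩ := hgu.exists_right_inv
  -- With F₀ = X^m g and W = 1/g, the residue of N E^j / F₀^(j+1) is the coefficient of N E^j
  -- W^(j+1) in degree m (j + 1) - 1.
  refine ⟨fun j i => if i ≤ m * (j + 1) - 1 then
    PowerSeries.coeff (m * (j + 1) - 1 - i) (W ^ (j + 1)) else 0, fun S _ _ F hF => ?_⟩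
  set E := F₀.map (algebraMap K S) - F with hE
  set W' := PowerSeries.map (algebraMap K S) W with hW'
  set v : S⸨X⸩ := HahnSeries.single (-(m : ℤ)) 1 * HahnSeries.ofPowerSeries ℤ S W' with hv
  have hv0 : laurentHom S (F₀.map (algebraMap K S)) * v = 1 := by
    conv_lhs => rw [hg, Polynomial.map_mul, Polynomial.map_pow, map_X, map_mul, laurentHom_X_pow, hv,
      mul_mul_mul_comm, HahnSeries.single_mul_single, laurentHom_apply, ← map_mul,
      Polynomial.polynomial_map_coe, hW', ← map_mul, hW]
    simp
  have hvpow : ∀ j : ℕ, v ^ j = HahnSeries.single (-(m * j : ℤ)) 1 *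
      HahnSeries.ofPowerSeries ℤ S (PowerSeries.map (algebraMap K S) (W ^ j)) := fun j => by
    rw [hv, mul_pow, HahnSeries.single_pow, hW', map_pow (PowerSeries.map _), map_pow (HahnSeries.ofPowerSeries ℤ S), one_pow,
      nsmul_eq_mul, mul_neg, mul_comm (j : ℤ)]
  -- This is 1 / (F₀ - E) as a geometric series, where v = 1 / F₀; it stops because E^(D+1) = 0.
  refine ⟨∑ j ∈ Finset.range (D + 1), laurentHom S E ^ j * v ^ (j + 1), ?_, ?_⟩
  · have e1 : laurentHom S F * v = 1 - laurentHom S E * v := by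
      rw [hE, map_sub]; linear_combination hv0
    have e2 : ∑ j ∈ Finset.range (D + 1), laurentHom S E ^ j * v ^ (j + 1) =
        v * ∑ j ∈ Finset.range (D + 1), (laurentHom S E * v) ^ j := by
      rw [Finset.mul_sum]
      exact Finset.sum_congr rfl fun j _ => by rw [mul_pow]; ring
    rw [e2, ← mul_assoc, e1, mul_neg_geom_sum, mul_pow, ← map_pow, hF]
    simp
  · intro N M hM
    rw [Finset.mul_sum, HahnSeries.coeff_sum]
    refine Finset.sum_congr rfl fun j hj => ?_
    rw [← mul_assoc, ← map_pow, ← map_mul, hvpow]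
    have hN := hM j (Nat.lt_succ_iff.1 (Finset.mem_range.1 hj))
    set N' := N * E ^ j
    set r := m * (j + 1) - 1 with hr
    have hr' : (-1 : ℤ) - -(m * (j + 1 : ℕ) : ℤ) = r := by
      have : 1 ≤ m * (j + 1) := Nat.succ_le_of_lt (by positivity)
      rw [hr]; push_cast [this]; ring
    rw [mul_left_comm, laurentHom_apply, ← map_mul, HahnSeries.coeff_single_mul, one_mul, hr',
      LaurentSeries.coeff_coe_powerSeries, PowerSeries.coeff_mul,
      Finset.Nat.sum_antidiagonal_eq_sum_range_succ_mk]
    simp only [Polynomial.coeff_coe, PowerSeries.coeff_map]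
    set h : ℕ → S := fun i =>
      (if i ≤ r then PowerSeries.coeff (r - i) (W ^ (j + 1)) else 0) • N'.coeff i with hh
    have e1 : ∑ i ∈ Finset.range (r + 1), h i = ∑ i ∈ Finset.range (r + M + 1), h i := by
      refine Finset.sum_subset (Finset.range_subset_range.2 (by lia)) fun i _ hi => ?_
      rw [hh]
      simp only
      rw [if_neg (by simpa using hi), zero_smul]
    have e2 : ∑ i ∈ Finset.range (M + 1), h i = ∑ i ∈ Finset.range (r + M + 1), h i := by
      refine Finset.sum_subset (Finset.range_subset_range.2 (by lia)) fun i _ hi => ?_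
      rw [hh]
      simp only
      rw [coeff_eq_zero_of_natDegree_lt (hN.trans_lt (by simpa using hi)), smul_zero]
    refine Eq.trans (Finset.sum_congr rfl fun i hi => ?_) (e1.trans e2.symm)
    rw [hh]
    simp only
    rw [if_pos (Nat.lt_succ_iff.1 (Finset.mem_range.1 hi)), Algebra.smul_def, mul_comm]

end Residue

end Polynomial

/-! ### Restriction to a line -/

section Line

variable {K : Type u} [Field K] {σ : Type v}

/-- The restriction of a polynomial to the line through `x` in the direction `a`, as a polynomial in
the parameter of the line. -/
noncomputable def line {T : Type*} [CommRing T] [Algebra K T] (x : σ → T) (a : σ → K) :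
    MvPolynomial σ K →ₐ[K] Polynomial T :=
  aeval fun j => Polynomial.C (x j) + Polynomial.C (algebraMap K T (a j)) * Polynomial.X

variable {T : Type*} [CommRing T] [Algebra K T]

theorem line_X (x : σ → T) (a : σ → K) (j : σ) :
    line x a (X j) =
      Polynomial.C (x j) + Polynomial.C (algebraMap K T (a j)) * Polynomial.X := by
  simp [line]

theorem line_C (x : σ → T) (a : σ → K) (r : K) :
    line x a (C r) = Polynomial.C (algebraMap K T r) := by
  rw [line, algHom_C]; rfl

theorem map_line {T' : Type*} [CommRing T'] [Algebra K T'] (ψ : T →ₐ[K] T') (x : σ → T) (a : σ → K)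
    (P : MvPolynomial σ K) :
    (line x a P).map (ψ : T →+* T') = line (fun j => ψ (x j)) a P := by
  have : (Polynomial.mapAlgHom ψ).comp (line x a) = line (fun j => ψ (x j)) a := by
    ext j
    simp [line_X]
  exact DFunLike.congr_fun this P

theorem eval_line (x : σ → T) (a : σ → K) (s : T) (P : MvPolynomial σ K) :
    (line x a P).eval s = aeval (fun j => x j + algebraMap K T (a j) * s) P := by
  induction P using MvPolynomial.induction_on with
  | C r => simp
  | add P Q hP hQ => simp [hP, hQ]
  | mul_X P j hP => simp [hP, line_X]

theorem line_comp_X_add_C (x : σ → T) (a : σ → K) (s : T) (P : MvPolynomial σ K) :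
    (line x a P).comp (Polynomial.X + Polynomial.C s) =
      line (fun j => x j + algebraMap K T (a j) * s) a P := by
  induction P using MvPolynomial.induction_on with
  | C r => simp
  | add P Q hP hQ => simp [hP, hQ]
  | mul_X P j hP =>
    rw [map_mul, map_mul, Polynomial.mul_comp, hP, line_X, line_X]
    simp
    ring

theorem derivative_line [Fintype σ] (x : σ → T) (a : σ → K) (P : MvPolynomial σ K) :
    Polynomial.derivative (line x a P) = line x a (∑ j, C (a j) * pderiv j P) := by
  classical
  induction P using MvPolynomial.induction_on with
  | C r => simp
  | add P Q hP hQ => simp [hP, hQ, mul_add, Finset.sum_add_distrib]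
  | mul_X P j hP =>
    have e : ∑ i, C (a i) * pderiv i (P * X j) =
        (∑ i, C (a i) * pderiv i P) * X j + C (a j) * P := by
      simp only [pderiv_mul, pderiv_X, mul_add, Finset.sum_add_distrib, Finset.sum_mul]
      congr 1
      · exact Finset.sum_congr rfl fun i _ => by ring
      · rw [Finset.sum_eq_single j]
        · simp
        · intro i _ h; simp [h.symm]
        · simp
    rw [e, map_mul, Polynomial.derivative_mul, hP, map_add, map_mul, map_mul, line_C]
    simp [line_X]
    ring

theorem natDegree_prod_line_le (x : σ → T) (a : σ → K) (m : σ → ℕ) (s : Finset σ) :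
    (∏ j ∈ s, line x a (X j) ^ m j).natDegree ≤ ∑ j ∈ s, m j ∧
    (∏ j ∈ s, line x a (X j) ^ m j).coeff (∑ j ∈ s, m j) =
      algebraMap K T (∏ j ∈ s, a j ^ m j) := by
  classical
  induction s using Finset.induction_on with
  | empty => simp
  | insert j s hj ih =>
    have h1 : (line x a (X j)).natDegree ≤ 1 := by
      rw [line_X]; compute_degree
    have h2 : (line x a (X j) ^ m j).natDegree ≤ m j :=
      (Polynomial.natDegree_pow_le_of_le _ h1).trans_eq (mul_one _)
    rw [Finset.prod_insert hj, Finset.sum_insert hj, Finset.prod_insert hj]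
    refine ⟨Polynomial.natDegree_mul_le_of_le h2 ih.1, ?_⟩
    rw [Polynomial.coeff_mul_add_eq_of_natDegree_le h2 ih.1, ih.2]
    have h3 := Polynomial.coeff_pow_of_natDegree_le (m := m j) h1
    rw [mul_one] at h3
    rw [h3, line_X, map_mul, map_pow]
    simp [Polynomial.coeff_C]

/-- In degree d only the homogeneous part of degree d contributes, and only through the direction.
The leading coefficient thus does not depend on the base point. -/
theorem line_degree (x : σ → T) (a : σ → K) {d : ℕ} {P : MvPolynomial σ K}
    (hP : P.totalDegree ≤ d) :
    (line x a P).natDegree ≤ d ∧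
    (line x a P).coeff d = algebraMap K T (eval a (homogeneousComponent d P)) := by
  classical
  have key : ∀ m ∈ P.support, (line x a (monomial m (P.coeff m))).natDegree ≤ d ∧
      (line x a (monomial m (P.coeff m))).coeff d =
        algebraMap K T (eval a (homogeneousComponent d (monomial m (P.coeff m)))) := by
    intro m hm
    have hd : m.degree ≤ d := by
      refine le_trans ?_ hP
      exact le_totalDegree hm
    have h1 := natDegree_prod_line_le x a m m.support
    have h0 : ∑ j ∈ m.support, m j = m.degree := rfl
    rw [h0] at h1
    have e : line x a (monomial m (P.coeff m)) =
        Polynomial.C (algebraMap K T (P.coeff m)) * ∏ j ∈ m.support, line x a (X j) ^ m j := by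
      rw [monomial_eq, map_mul, line_C, Finsupp.prod, map_prod]
      simp
    rw [e]
    refine ⟨(Polynomial.natDegree_C_mul_le _ _).trans (h1.1.trans hd), ?_⟩
    rw [Polynomial.coeff_C_mul]
    have hh := homogeneousComponent_of_mem (m := d)
      ((mem_homogeneousSubmodule _ _).2 (isHomogeneous_monomial (P.coeff m) (rfl : m.degree = _)))
    rw [hh]
    split_ifs with h
    · rw [h, h1.2, eval_monomial, map_mul]
      rfl
    · rw [Polynomial.coeff_eq_zero_of_natDegree_lt (h1.1.trans_lt (lt_of_le_of_ne hd (Ne.symm h)))]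
      simp
  rw [P.as_sum, map_sum]
  refine ⟨Polynomial.natDegree_sum_le_of_forall_le _ _ fun m hm => (key m hm).1, ?_⟩
  rw [Polynomial.finsetSum_coeff, map_sum, map_sum, map_sum]
  exact Finset.sum_congr rfl fun m hm => (key m hm).2

theorem homogeneousComponent_totalDegree_ne_zero {P : MvPolynomial σ K} (hP : P ≠ 0) :
    homogeneousComponent P.totalDegree P ≠ 0 := by
  obtain ⟨m, hm, hm'⟩ := Finset.exists_mem_eq_sup P.support (support_nonempty.2 hP)
    fun s => s.sum fun _ e => e
  intro h
  have h1 := congrArg (coeff m) h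
  rw [coeff_homogeneousComponent, coeff_zero, if_pos] at h1
  · exact mem_support_iff.1 hm h1
  · exact hm'.symm

theorem natDegree_line (x : σ → T) {a : σ → K} {P : MvPolynomial σ K} [Nontrivial T]
    (ha : eval a (homogeneousComponent P.totalDegree P) ≠ 0) :
    (line x a P).natDegree = P.totalDegree := by
  obtain ⟨h1, h2⟩ := line_degree x a le_rfl (P := P)
  refine le_antisymm h1 (Polynomial.le_natDegree_of_ne_zero ?_)
  rw [h2]
  simpa using ha

end Line

/-! ### Generic lines and separability -/

section Generic

variable {K : Type u} [Field K] {σ : Type v}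

/-- A vanishing partial derivative excludes monomials whose exponent in that variable is not
divisible by p. Over a perfect field the coefficients have p-th roots too. -/
theorem exists_pow_eq_of_pderiv_eq_zero (p : ℕ) (hp : p.Prime) [CharP K p] [PerfectRing K p]
    {P : MvPolynomial σ K} (h : ∀ j, pderiv j P = 0) : ∃ Q, P = Q ^ p := by
  have := Fact.mk hp
  have hdvd : ∀ m ∈ P.support, ∀ j, p ∣ m j := by
    intro m hm j
    by_contra hj
    have hj0 : m j ≠ 0 := fun h0 => hj (h0 ▸ dvd_zero p)
    have h1 := congrArg (coeff (m - Finsupp.single j 1)) (h j)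
    have h2 : m - Finsupp.single j 1 + Finsupp.single j 1 = m :=
      tsub_add_cancel_of_le (by simpa using Nat.one_le_iff_ne_zero.2 hj0)
    rw [coeff_pderiv, h2, coeff_zero, mul_eq_zero] at h1
    rcases h1 with h1 | h1
    · exact mem_support_iff.1 hm h1
    · apply hj
      rw [← CharP.cast_eq_zero_iff K p, ← h1]
      have h3 : ((m - Finsupp.single j 1 : σ →₀ ℕ) j) + 1 = m j := by
        simp [Nat.sub_add_cancel (Nat.one_le_iff_ne_zero.2 hj0)]
      rw [← h3, Nat.cast_add, Nat.cast_one]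
  refine ⟨∑ m ∈ P.support, monomial (m.mapRange (· / p) (Nat.zero_div p))
    ((frobeniusEquiv K p).symm (P.coeff m)), ?_⟩
  rw [sum_pow_char]
  conv_lhs => rw [P.as_sum]
  refine Finset.sum_congr rfl fun m hm => ?_
  have e : p • m.mapRange (· / p) (Nat.zero_div p) = m := by
    ext j
    simp [Nat.mul_div_cancel' (hdvd m hm j)]
  rw [monomial_pow, frobeniusEquiv_symm_pow_p, e]

theorem Irreducible.exists_pderiv_ne_zero (p : ℕ) (hp : p.Prime) [CharP K p] [PerfectRing K p]
    {P : MvPolynomial σ K} (hP : Irreducible P) : ∃ j, pderiv j P ≠ 0 := by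
  by_contra! h
  obtain ⟨Q, rfl⟩ := exists_pow_eq_of_pderiv_eq_zero p hp h
  exact not_irreducible_pow hp.ne_one hP

/-- A generic direction: the polynomials keep their degree and their separability. -/
theorem exists_generic_direction [Infinite K] [Fintype σ] (p : ℕ) (hp : p.Prime) [CharP K p]
    [PerfectRing K p] (s : Finset (MvPolynomial σ K)) (hs : ∀ w ∈ s, Irreducible w) :
    ∃ a : σ → K, ∀ w ∈ s, eval a (homogeneousComponent w.totalDegree w) ≠ 0 ∧
      ∑ j, C (a j) * pderiv j w ≠ 0 := by
  classical
  have h : ∀ w ∈ s, ∃ L : MvPolynomial σ K, L ≠ 0 ∧ ∀ a, eval a L ≠ 0 →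
      ∑ j, C (a j) * pderiv j w ≠ 0 := by
    intro w hw
    obtain ⟨i, hi⟩ := (hs w hw).exists_pderiv_ne_zero p hp
    obtain ⟨m, hm⟩ := ne_zero_iff.1 hi
    -- This is one coefficient of the directional derivative, viewed as a linear form in the
    -- direction.
    refine ⟨∑ j, C (coeff m (pderiv j w)) * X j, fun h0 => hm ?_, fun a ha h0 => ha ?_⟩
    · have := congrArg (eval (Pi.single i 1)) h0
      simpa [Pi.single_apply] using this
    · have := congrArg (coeff m) h0
      simpa [coeff_sum, coeff_C_mul, mul_comm] using this
  choose! L hL0 hL using h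
  set Q := ∏ w ∈ s, homogeneousComponent w.totalDegree w * L w
  have hQ : Q ≠ 0 := Finset.prod_ne_zero_iff.2 fun w hw =>
    mul_ne_zero (homogeneousComponent_totalDegree_ne_zero (hs w hw).ne_zero) (hL0 w hw)
  obtain ⟨a, ha⟩ : ∃ a, eval a Q ≠ 0 := by
    by_contra! h
    exact hQ (MvPolynomial.funext fun x => by simpa using h x)
  refine ⟨a, fun w hw => ?_⟩
  have := Finset.prod_ne_zero_iff.1 (by rwa [map_prod] at ha) w hw
  rw [map_mul] at this
  exact ⟨left_ne_zero_of_mul this, hL w hw a (right_ne_zero_of_mul this)⟩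

/-- The shear `X j ↦ X j + a j Y` of `K[X][Y]`. -/
noncomputable def shearHom (a : σ → K) :
    Polynomial (MvPolynomial σ K) →+* Polynomial (MvPolynomial σ K) :=
  Polynomial.eval₂RingHom (line (X : σ → MvPolynomial σ K) a).toRingHom Polynomial.X

theorem shearHom_C (a : σ → K) (P : MvPolynomial σ K) :
    shearHom a (Polynomial.C P) = line (X : σ → MvPolynomial σ K) a P := by
  simp [shearHom]

theorem shearHom_comp (a : σ → K) : (shearHom (-a)).comp (shearHom a) = RingHom.id _ := by
  refine Polynomial.ringHom_ext' ?_ ?_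
  · refine MvPolynomial.ringHom_ext (fun r => ?_) fun j => ?_
    · simp [shearHom_C, algebraMap_eq]
    · simp only [RingHom.comp_apply, shearHom_C, line_X, algebraMap_eq, map_add, map_mul, line_C,
        RingHom.id_apply]
      simp [shearHom]
  · simp [shearHom]

/-- The shear as a ring automorphism. -/
noncomputable def shearEquiv (a : σ → K) :
    Polynomial (MvPolynomial σ K) ≃+* Polynomial (MvPolynomial σ K) :=
  RingEquiv.ofRingHom (shearHom a) (shearHom (-a))
    (by simpa using shearHom_comp (-a)) (shearHom_comp a)

theorem shearEquiv_C (a : σ → K) (P : MvPolynomial σ K) :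
    shearEquiv a (Polynomial.C P) = line (X : σ → MvPolynomial σ K) a P := shearHom_C a P

/-- The shear is an automorphism that takes the constant polynomial w, which is still prime, to the
restriction of w to the line. -/
theorem irreducible_line_X {w : MvPolynomial σ K} (hw : Irreducible w) (a : σ → K) :
    Irreducible (line (X : σ → MvPolynomial σ K) a w) := by
  rw [← shearEquiv_C]
  exact (MulEquiv.irreducible_iff (shearEquiv a)).2 (Polynomial.prime_C_iff.2 hw.prime).irreducible

theorem dvd_of_line_X_dvd {v w : MvPolynomial σ K} {a : σ → K} (h : line (X : σ → MvPolynomial σ K) a v ∣ line (X : σ → MvPolynomial σ K) a w) :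
    v ∣ w := by
  rw [← shearEquiv_C, ← shearEquiv_C, map_dvd_iff] at h
  simpa using Polynomial.C_dvd_iff_dvd_coeff _ _ |>.1 h 0

/-- The top coefficient is a nonzero constant. Primitivity lets Gauss's lemma carry irreducibility
and divisibility to and from the fraction field. -/
theorem isPrimitive_line_X {w : MvPolynomial σ K} {a : σ → K}
    (ha : eval a (homogeneousComponent w.totalDegree w) ≠ 0) :
    (line (X : σ → MvPolynomial σ K) a w : Polynomial (MvPolynomial σ K)).IsPrimitive := by
  intro r hr
  have h1 := (Polynomial.C_dvd_iff_dvd_coeff _ _).1 hr w.totalDegree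
  rw [(line_degree _ a le_rfl).2] at h1
  exact isUnit_of_dvd_unit h1 ((isUnit_iff_ne_zero.2 ha).map (algebraMap K _))

/-- On a generic line, pairwise distinct irreducible polynomials keep their degree and their product
is separable. -/
theorem exists_generic_line [Infinite K] [Fintype σ] (p : ℕ) (hp : p.Prime) [CharP K p]
    [PerfectRing K p] (s : Finset (MvPolynomial σ K)) (hs : ∀ w ∈ s, Irreducible w)
    (hs' : ∀ v ∈ s, ∀ w ∈ s, v ≠ w → ¬ v ∣ w) :
    ∃ a x : σ → K, (∀ w ∈ s, eval a (homogeneousComponent w.totalDegree w) ≠ 0) ∧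
      (∏ w ∈ s, line x a w).Separable := by
  obtain ⟨a, ha⟩ := exists_generic_direction p hp s hs
  set M := FractionRing (MvPolynomial σ K)
  have hinj : Function.Injective (algebraMap (MvPolynomial σ K) M) := IsFractionRing.injective (MvPolynomial σ K) M
  have hprim := fun w hw => isPrimitive_line_X (ha w hw).1
  have hirr : ∀ w ∈ s, Irreducible ((line (X : σ → MvPolynomial σ K) a w).map (algebraMap (MvPolynomial σ K) M)) := fun w hw =>
    (hprim w hw).irreducible_iff_irreducible_map_fraction_map.1 (irreducible_line_X (hs w hw) a)
  -- Over the fraction field the factors are irreducible, pairwise coprime and have nonzero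
  -- derivative.
  have hsep : (∏ w ∈ s, (line (X : σ → MvPolynomial σ K) a w).map (algebraMap (MvPolynomial σ K) M)).Separable := by
    refine Polynomial.separable_prod' (fun v hv w hw hvw => ?_) fun w hw => ?_
    · refine ((hirr v hv).coprime_iff_not_dvd).2 fun h => ?_
      exact hs' v hv w hw hvw (dvd_of_line_X_dvd
        ((hprim v hv).dvd_of_fraction_map_dvd_fraction_map h))
    · rw [Polynomial.separable_iff_derivative_ne_zero (hirr w hw), Polynomial.derivative_map]
      rw [Polynomial.map_ne_zero_iff hinj, derivative_line]
      intro h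
      refine (ha w hw).2 (zero_dvd_iff.1 (dvd_of_line_X_dvd (a := a) ?_))
      rw [h]
      exact dvd_zero _
  rw [← Polynomial.map_prod] at hsep
  set Q := ∏ w ∈ s, line (X : σ → MvPolynomial σ K) a w with hQ
  obtain ⟨A, B, hAB⟩ := hsep
  obtain ⟨c, hc, hc'⟩ := IsLocalization.integerNormalization_spec (nonZeroDivisors (MvPolynomial σ K)) A
  obtain ⟨d, hd, hd'⟩ := IsLocalization.integerNormalization_spec (nonZeroDivisors (MvPolynomial σ K)) B
  set A' := IsLocalization.integerNormalization (nonZeroDivisors (MvPolynomial σ K)) A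
  set B' := IsLocalization.integerNormalization (nonZeroDivisors (MvPolynomial σ K)) B
  -- The Bézout identity of Q and Q' with denominators cleared. It proves separability at every
  -- point where the nonzero polynomial c d does not vanish.
  have key : Polynomial.C d * A' * Q + Polynomial.C c * B' * Polynomial.derivative Q =
      Polynomial.C (c * d) := by
    apply Polynomial.map_injective _ hinj
    simp only [Polynomial.map_add, Polynomial.map_mul, Polynomial.map_C, hc', hd',
      ← Polynomial.derivative_map]
    simp only [Algebra.smul_def, Polynomial.algebraMap_apply, map_mul]
    linear_combination Polynomial.C (algebraMap (MvPolynomial σ K) M c) * Polynomial.C (algebraMap (MvPolynomial σ K) M d) * hAB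
  have hcd : c * d ≠ 0 :=
    mul_ne_zero (nonZeroDivisors.ne_zero hc) (nonZeroDivisors.ne_zero hd)
  obtain ⟨x, hx⟩ : ∃ x, eval x (c * d) ≠ 0 := by
    by_contra! h
    exact hcd (MvPolynomial.funext fun x => by simpa using h x)
  refine ⟨a, x, fun w hw => (ha w hw).1, ?_⟩
  have e1 : Q.map (eval x) = ∏ w ∈ s, line x a w := by
    rw [hQ, Polynomial.map_prod]
    refine Finset.prod_congr rfl fun w _ => ?_
    have := map_line (aeval x : MvPolynomial σ K →ₐ[K] K) X a w
    simp only [aeval_X] at this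
    rw [← this]
    rfl
  have e2 := congrArg (Polynomial.map (eval x)) key
  simp only [Polynomial.map_add, Polynomial.map_mul, Polynomial.map_C,
      ← Polynomial.derivative_map, e1] at e2
  have e3 : Polynomial.C (eval x (c * d))⁻¹ * Polynomial.C (eval x (c * d)) = 1 := by
    rw [← Polynomial.C_mul, inv_mul_cancel₀ hx, Polynomial.C_1]
  exact ⟨Polynomial.C (eval x (c * d))⁻¹ * (Polynomial.C (eval x d) * A'.map (eval x)),
    Polynomial.C (eval x (c * d))⁻¹ * (Polynomial.C (eval x c) * B'.map (eval x)), by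
      linear_combination Polynomial.C (eval x (c * d))⁻¹ * e2 + e3⟩

end Generic

theorem IsUnit.of_sub_isNilpotent {S : Type*} [CommRing S] {r s : S} (hr : IsUnit r)
    (h : IsNilpotent (s - r)) : IsUnit s := by
  have := h.isUnit_add_left_of_commute hr (Commute.all _ _)
  rwa [add_sub_cancel] at this

/-! ### Lifting roots modulo nilpotents -/

section Hensel

variable {K : Type u} [Field K] {σ : Type v} {S : Type*} [CommRing S] [Algebra K S]

/-- Modulo t the two base points, hence the two lines, coincide. For nilpotent t this makes one
restriction a nilpotent perturbation of the other. -/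
theorem C_dvd_line_sub_map_line {t : S} {y : σ → S} {x : σ → K}
    (h : ∀ j, t ∣ y j - algebraMap K S (x j)) (a : σ → K) (P : MvPolynomial σ K) :
    Polynomial.C t ∣ line y a P - (line x a P).map (algebraMap K S) := by
  have e : ∀ P, (line x a P).map (algebraMap K S) = line (fun j => algebraMap K S (x j)) a P :=
    fun P => map_line (Algebra.ofId K S) x a P
  rw [e]
  induction P using MvPolynomial.induction_on with
  | C r => simp
  | add P Q hP hQ =>
    rw [map_add, map_add, add_sub_add_comm]
    exact dvd_add hP hQ
  | mul_X P j hP =>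
    have h1 : Polynomial.C t ∣ line y a (X j) - line (fun j => algebraMap K S (x j)) a (X j) := by
      rw [line_X, line_X, add_sub_add_right_eq_sub, ← Polynomial.C_sub]
      exact Polynomial.C.map_dvd (h j)
    rw [map_mul, map_mul]
    exact dvd_mul_sub_mul hP h1

theorem isNilpotent_eval_line_sub {t : S} (ht : IsNilpotent t) {y : σ → S} {x : σ → K}
    (h : ∀ j, t ∣ y j - algebraMap K S (x j)) (a : σ → K)
    (P : MvPolynomial σ K) (β : K) :
    IsNilpotent ((line y a P).eval (algebraMap K S β) - algebraMap K S ((line x a P).eval β)) := by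
  obtain ⟨Q, hQ⟩ := C_dvd_line_sub_map_line h a P
  have := congrArg (Polynomial.eval (algebraMap K S β)) hQ
  rw [Polynomial.eval_sub, Polynomial.eval_map_algebraMap, Polynomial.aeval_algebraMap_apply_eq_algebraMap_eval,
    Polynomial.eval_mul, Polynomial.eval_C] at this
  rw [this]
  exact (Commute.all _ _).isNilpotent_mul_right ht

theorem isNilpotent_eval_derivative_line_sub {t : S} (ht : IsNilpotent t) {y : σ → S} {x : σ → K}
    (h : ∀ j, t ∣ y j - algebraMap K S (x j)) (a : σ → K)
    (P : MvPolynomial σ K) (β : K) :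
    IsNilpotent ((line y a P).derivative.eval (algebraMap K S β) -
      algebraMap K S ((line x a P).derivative.eval β)) := by
  obtain ⟨Q, hQ⟩ := C_dvd_line_sub_map_line h a P
  have := congrArg (fun R => Polynomial.eval (algebraMap K S β) (Polynomial.derivative R)) hQ
  simp only [Polynomial.derivative_sub, Polynomial.derivative_map, Polynomial.derivative_C_mul] at this
  rw [Polynomial.eval_sub, Polynomial.eval_map_algebraMap, Polynomial.aeval_algebraMap_apply_eq_algebraMap_eval,
    Polynomial.eval_mul, Polynomial.eval_C] at this
  rw [this]
  exact (Commute.all _ _).isNilpotent_mul_right ht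

/-- Hensel's lemma for a simple root on a line. -/
theorem exists_root_line {t : S} (ht : IsNilpotent t) {y : σ → S} {x : σ → K}
    (h : ∀ j, t ∣ y j - algebraMap K S (x j)) (a : σ → K)
    {w : MvPolynomial σ K} {β : K} (hβ : (line x a w).eval β = 0)
    (hβ' : (line x a w).derivative.eval β ≠ 0) :
    ∃ φ : S, IsNilpotent (φ - algebraMap K S β) ∧
      ∃ V, line y a w = (Polynomial.X - Polynomial.C φ) * V ∧
        IsUnit (V.eval (algebraMap K S β)) := by
  have h1 := isNilpotent_eval_line_sub ht h a w β
  rw [hβ, map_zero, sub_zero] at h1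
  have h2 : IsUnit ((line y a w).derivative.eval (algebraMap K S β)) :=
    ((isUnit_iff_ne_zero.2 hβ').map (algebraMap K S)).of_sub_isNilpotent
      (isNilpotent_eval_derivative_line_sub ht h a w β)
  obtain ⟨φ, ⟨hφ, hφ'⟩, -⟩ := Polynomial.existsUnique_nilpotent_sub_and_aeval_eq_zero
    (P := line y a w) (x := algebraMap K S β) (by simpa using h1) (by simpa using h2)
  have hφ : IsNilpotent (φ - algebraMap K S β) := by simpa using hφ.neg
  obtain ⟨V, hV⟩ := Polynomial.dvd_iff_isRoot.2
    (show (line y a w).IsRoot φ by simpa using hφ')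
  have nil : ∀ Q : Polynomial S, IsNilpotent (Q.eval φ - Q.eval (algebraMap K S β)) := fun Q => by
    obtain ⟨r, hr⟩ := Polynomial.sub_dvd_eval_sub φ (algebraMap K S β) Q
    rw [hr]
    exact (Commute.all _ _).isNilpotent_mul_right hφ
  refine ⟨φ, hφ, V, hV, ?_⟩
  have h3 := h2.of_sub_isNilpotent (nil _)
  -- Differentiating (X - φ) V at φ leaves V(φ), which differs from V(β) by a nilpotent.
  have h4 : (line y a w).derivative.eval φ = V.eval φ := by
    rw [hV]; simp
  rw [h4] at h3
  refine h3.of_sub_isNilpotent ?_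
  rw [← neg_sub]
  exact (nil V).neg

/-- The restriction of a polynomial to a line splits if it is congruent to a split separable
polynomial up to nilpotents. -/
theorem line_eq_prod [IsAlgClosed K] [DecidableEq K] {y : σ → S} {x : σ → K} (a : σ → K)
    {w : MvPolynomial σ K}
    (ha : eval a (homogeneousComponent w.totalDegree w) ≠ 0) (hw : (line x a w).Separable)
    {φ : K → S} (hφ : ∀ β ∈ (line x a w).roots.toFinset, IsNilpotent (φ β - algebraMap K S β) ∧
      (line y a w).eval (φ β) = 0) :
    line y a w = Polynomial.C (algebraMap K S (eval a (homogeneousComponent w.totalDegree w))) *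
      ∏ β ∈ (line x a w).roots.toFinset, (Polynomial.X - Polynomial.C (φ β)) := by
  rcases subsingleton_or_nontrivial S with hS | hS
  · exact Subsingleton.elim _ _
  set Z := (line x a w).roots.toFinset with hZ
  have hcard : Z.card = w.totalDegree := by
    rw [← natDegree_line x ha, hZ, Multiset.toFinset_card_of_nodup (Polynomial.nodup_roots hw)]
    exact (IsAlgClosed.splits _).natDegree_eq_card_roots.symm
  -- The roots β are distinct in K, so differences of the lifts are units and the linear factors are
  -- pairwise coprime.
  obtain ⟨Q, hQ⟩ : ∏ β ∈ Z, (Polynomial.X - Polynomial.C (φ β)) ∣ line y a w := by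
    refine Finset.prod_dvd_of_coprime (fun β hβ γ hγ hne => ?_) fun β hβ => ?_
    · refine Polynomial.isCoprime_X_sub_C_of_isUnit_sub ?_
      refine ((isUnit_iff_ne_zero.2 (sub_ne_zero.2 hne)).map (algebraMap K S)).of_sub_isNilpotent ?_
      have := (Commute.all _ _).isNilpotent_sub (hφ β hβ).1 (hφ γ hγ).1
      rw [map_sub]
      convert this using 1
      ring
    · exact Polynomial.dvd_iff_isRoot.2 (hφ β hβ).2
  have hmonic : (∏ β ∈ Z, (Polynomial.X - Polynomial.C (φ β))).Monic :=
    Polynomial.monic_prod_of_monic _ _ fun β _ => Polynomial.monic_X_sub_C _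
  have hdeg : (∏ β ∈ Z, (Polynomial.X - Polynomial.C (φ β))).natDegree = w.totalDegree := by
    rw [Polynomial.natDegree_prod_of_monic _ _ fun β _ => Polynomial.monic_X_sub_C _]
    simp [hcard]
  obtain ⟨h1, h2⟩ := line_degree y a le_rfl (P := w)
  -- The monic product already has full degree, so the cofactor is a constant, read off from the top
  -- coefficient.
  have hQ0 : Q.natDegree = 0 := by
    by_cases h0 : Q = 0
    · simp [h0]
    · rw [hQ, hmonic.natDegree_mul' h0, hdeg] at h1
      lia
  rw [Polynomial.eq_C_of_natDegree_eq_zero hQ0] at hQ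
  rw [hQ, mul_comm, Polynomial.coeff_C_mul] at h2
  rw [← hdeg] at h2
  rw [hmonic.coeff_natDegree, mul_one, hdeg] at h2
  rw [hQ, h2, mul_comm]

end Hensel

/-- The constants of the formula `RootData.formula`. -/
structure RootData (K : Type u) where
  /-- coefficients of the residue functional -/
  w : ℕ → ℕ → K
  /-- coefficients of the Hasse derivative -/
  b : ℕ → ℕ → K
  /-- values of the unperturbed polynomial -/
  c : ℕ → K
  /-- additive constant -/
  r : K

/-- A power of a root of a polynomial of degree at most `d`, as a function of its values `v`. -/
noncomputable def RootData.formula {K : Type u} [Field K] {S : Type*} [CommRing S] [Algebra K S]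
    (R : RootData K) (d : ℕ) (v : ℕ → S) : S :=
  algebraMap K S R.r + ∑ j ∈ Finset.range (d + 1), ∑ k ∈ Finset.range (3 * d + d * d + 1),
    R.w j k • ((∑ i ∈ Finset.range (d + 1), R.b k i • v i) * (algebraMap K S (R.c k) - v k) ^ j)

/-- Only ring operations and constants of K occur. This lets the formula pass to the quotient by
t^(d+1) and to the values t = τ. -/
theorem RootData.map_formula {K : Type u} [Field K] {S T : Type*} [CommRing S] [Algebra K S]
    [CommRing T] [Algebra K T] (ψ : S →ₐ[K] T) (R : RootData K) (d : ℕ) (v : ℕ → S) :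
    ψ (R.formula d v) = R.formula d fun i => ψ (v i) := by
  simp [RootData.formula]

/-! ### Powers of roots from values -/

namespace Polynomial

/-- The `q`-th power of a root of multiplicity `q e`, `q = p ^ l`, `p ∤ e`, that is close to `0`. -/
theorem exists_rootData {K : Type u} [Field K] {p : ℕ} (hp : p.Prime) [CharP K p] (η : ℕ → K)
    (hη : Function.Injective η) {d : ℕ} {F₀ : K[X]} (h0 : F₀ ≠ 0) (h1 : F₀.coeff 0 = 0)
    (hd : F₀.natDegree ≤ d) {l e : ℕ} (he : ¬ p ∣ e) (hl : p ^ l ≤ d) :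
    ∃ R : RootData K, R.r = 0 ∧ ∀ (S : Type v) [CommRing S] [Algebra K S] (F U : S[X]) (s : S),
      F.natDegree ≤ d → (F₀.map (algebraMap K S) - F) ^ (d + 1) = 0 → IsNilpotent s →
      F = (X - C s) ^ (p ^ l * e) * U → IsUnit (U.coeff 0) →
      R.formula d (fun i => F.eval (algebraMap K S (η i))) = s ^ p ^ l := by
  obtain ⟨w, hw⟩ := exists_residue_functional.{u, v} h0 h1 d
  choose c hc using fun j => exists_sum_eval_eq.{u, v} η hη (3 * d + d * d) (w j)
  -- These weights express D_q F at `η k` by the coefficients of F, and interpolation turns them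
  -- into weights on values. For i < q the binomial coefficient is 0, so the truncated exponent is
  -- harmless.
  choose b hb using fun k => exists_sum_eval_eq.{u, v} η hη d
    fun i => (i.choose (p ^ l) : K) * η k ^ (i - p ^ l)
  have he0 : (e : K) ≠ 0 := fun h => he ((CharP.cast_eq_zero_iff K p e).1 h)
  -- The inverse of e normalizes the residue e s^q, and the power of `η k` is the value of X^(2q-1).
  refine ⟨⟨fun j k => (e : K)⁻¹ * (c j k * η k ^ (2 * p ^ l - 1)), b, fun k => F₀.eval (η k), 0⟩,
    rfl, ?_⟩
  intro S _ _ F U s hF hE hs hFU hU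
  rcases subsingleton_or_nontrivial S with hS | hS
  · exact Subsingleton.elim _ _
  have : CharP S p := charP_of_injective_algebraMap (algebraMap K S).injective p
  obtain ⟨G, hG, hG'⟩ := hw S F hE
  have h2 := coeff_hasseDeriv_mul_inverse hp l e hs hFU hU hG
  -- The three factors contribute at most 2q - 1, d and d², and q ≤ d.
  have hdeg : ∀ j ≤ d, (X ^ (2 * p ^ l - 1) * hasseDeriv (p ^ l) F *
      (F₀.map (algebraMap K S) - F) ^ j).natDegree ≤ 3 * d + d * d := by
    intro j hj
    have e1 : (hasseDeriv (p ^ l) F).natDegree ≤ d :=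
      (natDegree_hasseDeriv_le F _).trans ((Nat.sub_le _ _).trans hF)
    have e2 : (F₀.map (algebraMap K S) - F).natDegree ≤ d :=
      (natDegree_sub_le_of_le (natDegree_map_le.trans hd) hF).trans_eq (max_self d)
    have e3 : ((F₀.map (algebraMap K S) - F) ^ j).natDegree ≤ d * d :=
      (natDegree_pow_le_of_le j e2).trans (Nat.mul_le_mul_right d hj)
    refine (natDegree_mul_le_of_le (natDegree_mul_le_of_le (natDegree_X_pow_le _) e1) e3).trans ?_
    lia
  rw [hG' _ _ hdeg] at h2
  have hD : ∀ k, (hasseDeriv (p ^ l) F).eval (algebraMap K S (η k)) =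
      ∑ i ∈ Finset.range (d + 1), b k i • F.eval (algebraMap K S (η i)) := by
    intro k
    rw [hb k S F hF, hasseDeriv_apply, sum_over_range' _ _ (d + 1) (Nat.lt_succ_of_le hF),
      eval_finsetSum]
    · refine Finset.sum_congr rfl fun i _ => ?_
      rw [eval_monomial, Algebra.smul_def]
      simp
      ring
    · simp
  have hsum : ∀ j ∈ Finset.range (d + 1), ∑ i ∈ Finset.range (3 * d + d * d + 1),
      w j i • (X ^ (2 * p ^ l - 1) * hasseDeriv (p ^ l) F *
        (F₀.map (algebraMap K S) - F) ^ j).coeff i =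
      ∑ k ∈ Finset.range (3 * d + d * d + 1), (c j k * η k ^ (2 * p ^ l - 1)) •
        ((∑ i ∈ Finset.range (d + 1), b k i • F.eval (algebraMap K S (η i))) *
          (algebraMap K S (F₀.eval (η k)) - F.eval (algebraMap K S (η k))) ^ j) := by
    intro j hj
    rw [← hc j S _ (hdeg j (Nat.lt_succ_iff.1 (Finset.mem_range.1 hj)))]
    refine Finset.sum_congr rfl fun k _ => ?_
    rw [eval_mul, eval_mul, eval_pow, eval_pow, eval_X, hD, eval_sub, eval_map_algebraMap,
      aeval_algebraMap_apply_eq_algebraMap_eval, mul_smul, mul_assoc, ← map_pow,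
      ← Algebra.smul_def]
  rw [Finset.sum_congr rfl hsum] at h2
  have h3 : (algebraMap K S (e : K)⁻¹) * (e * s ^ p ^ l) = s ^ p ^ l := by
    rw [← mul_assoc, ← map_natCast (algebraMap K S) e, ← map_mul, inv_mul_cancel₀ he0, map_one,
      one_mul]
  rw [← h3, ← h2, RootData.formula, map_zero, zero_add, Finset.mul_sum]
  refine Finset.sum_congr rfl fun j _ => ?_
  rw [Finset.mul_sum]
  refine Finset.sum_congr rfl fun k _ => ?_
  simp only
  rw [mul_smul, Algebra.smul_def]

end Polynomial

section Line

/-- The `q`-th power of a root on a line, where `q` is the largest power of `p` that divides its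
multiplicity, is given by a universal formula in the values on the line. -/
theorem exists_rootData_line {K : Type u} [Field K] {σ : Type v} {p : ℕ} (hp : p.Prime) [CharP K p]
    (η : ℕ → K) (hη : Function.Injective η) {d : ℕ} {f w f' : MvPolynomial σ K}
    (hd : f.totalDegree ≤ d) {l e : ℕ} (he : ¬ p ∣ e) (hl : p ^ l ≤ d)
    (hf : f = w ^ (p ^ l * e) * f') {x a : σ → K} {β : K} (hβ : (line x a w).eval β = 0)
    (hβ' : (line x a w).derivative.eval β ≠ 0) (hf' : (line x a f').eval β ≠ 0) :
    ∃ R : RootData K, ∀ (S : Type (max u v)) [CommRing S] [Algebra K S] (t : S) (y : σ → S),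
      t ^ (d + 1) = 0 → (∀ j, t ∣ y j - algebraMap K S (x j)) →
      ∃ φ : S, IsNilpotent (φ - algebraMap K S β) ∧ (line y a w).eval φ = 0 ∧
        R.formula d (fun i => aeval (fun j => y j + algebraMap K S (a j * (β + η i))) f) =
          φ ^ p ^ l := by
  have := Fact.mk hp
  have hl0 : 0 < p ^ l := pow_pos hp.pos l
  have he0 : 0 < e := Nat.pos_of_ne_zero fun h => he (h ▸ dvd_zero p)
  -- Translating the parameter by β brings the root to be lifted close to 0.
  set F₀ := line (fun j => x j + a j * β) a f with hF₀
  have hF₀' : F₀ = (line x a f).comp (Polynomial.X + Polynomial.C β) :=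
    (line_comp_X_add_C x a β f).symm
  have h0 : F₀ ≠ 0 := by
    rw [hF₀', ne_eq, Polynomial.comp_eq_zero_iff]
    rintro (h | h)
    · rw [hf, map_mul, map_pow] at h
      rcases mul_eq_zero.1 h with h | h
      · rw [pow_eq_zero_iff (Nat.mul_pos hl0 he0).ne'] at h
        rw [h] at hβ'
        simp at hβ'
      · rw [h] at hf'
        simp at hf'
    · have := congrArg (fun Q => Polynomial.coeff Q 1) h.2
      simp [Polynomial.coeff_C] at this
  have h1 : F₀.coeff 0 = 0 := by
    rw [hF₀', Polynomial.coeff_zero_eq_eval_zero, Polynomial.eval_comp, hf]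
    simp [hβ, hp.ne_zero, he0.ne']
  obtain ⟨R, hR0, hR⟩ := Polynomial.exists_rootData.{u, max u v} hp η hη h0 h1 (line_degree _ a hd).1 he hl
  -- The additive constant undoes the translation, because φ^q = (φ - β)^q + β^q in characteristic
  -- p.
  refine ⟨⟨R.w, R.b, R.c, β ^ p ^ l⟩, fun S _ _ t y ht hy => ?_⟩
  rcases subsingleton_or_nontrivial S with hS | hS
  · exact ⟨0, ⟨1, Subsingleton.elim _ _⟩, Subsingleton.elim _ _, Subsingleton.elim _ _⟩
  have hSp : CharP S p := charP_of_injective_algebraMap (algebraMap K S).injective p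
  have htn : IsNilpotent t := ⟨_, ht⟩
  obtain ⟨φ, hφ, V, hV, hVu⟩ := exists_root_line htn hy a hβ hβ'
  refine ⟨φ, hφ, by rw [hV]; simp, ?_⟩
  set y' : σ → S := fun j => y j + algebraMap K S (a j) * algebraMap K S β with hy'
  have hcomp := fun P => line_comp_X_add_C y a (algebraMap K S β) P
  set s := φ - algebraMap K S β with hs
  set Xβ : Polynomial S := Polynomial.X + Polynomial.C (algebraMap K S β) with hXβ
  have hfac : line y' a f = (Polynomial.X - Polynomial.C s) ^ (p ^ l * e) *
      (V.comp Xβ ^ (p ^ l * e) * (line y a f').comp Xβ) := by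
    rw [hy', ← hcomp f, hf, map_mul, map_pow, hV, Polynomial.mul_comp, Polynomial.pow_comp,
      Polynomial.mul_comp, mul_pow, mul_assoc]
    congr 2
    rw [hs, hXβ]
    simp
    ring
  have hunit : IsUnit ((V.comp Xβ ^ (p ^ l * e) * (line y a f').comp Xβ).coeff 0) := by
    rw [Polynomial.coeff_zero_eq_eval_zero, Polynomial.eval_mul, Polynomial.eval_pow,
      Polynomial.eval_comp, Polynomial.eval_comp]
    have e1 : Xβ.eval 0 = algebraMap K S β := by simp [hXβ]
    rw [e1]
    refine (hVu.pow _).mul ?_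
    exact ((isUnit_iff_ne_zero.2 hf').map (algebraMap K S)).of_sub_isNilpotent
      (isNilpotent_eval_line_sub htn hy a f' β)
  have hcongr : (F₀.map (algebraMap K S) - line y' a f) ^ (d + 1) = 0 := by
    obtain ⟨Q, hQ⟩ := C_dvd_line_sub_map_line (t := t) (y := y') (x := fun j => x j + a j * β)
      (fun j => by simpa [hy'] using hy j) a f
    rw [← neg_sub, hQ, neg_pow, mul_pow, ← Polynomial.C_pow, ht]
    simp
  have key := hR S (line y' a f) _ s (line_degree _ a hd).1 hcongr hφ hfac hunit
  have e2 : ∀ i, (line y' a f).eval (algebraMap K S (η i)) =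
      aeval (fun j => y j + algebraMap K S (a j * (β + η i))) f := fun i => by
    rw [eval_line]
    congr 2
    funext j
    simp [hy']
    ring
  simp only [e2] at key
  have e3 : φ ^ p ^ l = s ^ p ^ l + algebraMap K S (β ^ p ^ l) := by
    rw [map_pow, ← add_pow_char_pow, hs, sub_add_cancel]
  rw [e3, ← key, RootData.formula, RootData.formula, hR0]
  simp only [map_zero, zero_add]
  exact add_comm _ _

end Line

/-! ### Coprimality under field extension -/

section BaseChange

variable {F : Type u} {K : Type v} [Field F] [Field K] [Algebra F K] {σ : Type*}

/-- Apply a linear functional to all coefficients of a polynomial. -/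
noncomputable def coeffwise (ψ : K →ₗ[F] F) (P : MvPolynomial σ K) : MvPolynomial σ F :=
  ∑ m ∈ P.support, monomial m (ψ (P.coeff m))

theorem coeff_coeffwise (ψ : K →ₗ[F] F) (P : MvPolynomial σ K) (m : σ →₀ ℕ) :
    (coeffwise ψ P).coeff m = ψ (P.coeff m) := by
  classical
  rw [coeffwise, coeff_sum]
  simp only [coeff_monomial]
  rw [Finset.sum_ite_eq']
  split_ifs with h
  · rfl
  · rw [notMem_support_iff.1 h, map_zero]

theorem coeffwise_mul_map (ψ : K →ₗ[F] F) (P : MvPolynomial σ K) (Q : MvPolynomial σ F) :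
    coeffwise ψ (P * map (algebraMap F K) Q) = coeffwise ψ P * Q := by
  classical
  ext m
  rw [coeff_coeffwise, coeff_mul, coeff_mul, map_sum]
  refine Finset.sum_congr rfl fun i _ => ?_
  rw [coeff_coeffwise, coeff_map, mul_comm, ← Algebra.smul_def, map_smul, smul_eq_mul, mul_comm]

theorem totalDegree_coeffwise_le (ψ : K →ₗ[F] F) (P : MvPolynomial σ K) :
    (coeffwise ψ P).totalDegree ≤ P.totalDegree := by
  refine Finset.sup_le fun m hm => le_totalDegree ?_
  rw [mem_support_iff, coeff_coeffwise] at hm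
  exact mem_support_iff.2 fun h => hm (by rw [h, map_zero])

/-- Coprimality is preserved by extensions of the base field. -/
theorem IsRelPrime.map_algebraMap {g h : MvPolynomial σ F} (hh : h ≠ 0) (hgh : IsRelPrime g h) :
    IsRelPrime (map (algebraMap F K) g) (map (algebraMap F K) h) := by
  rintro r ⟨P, hP⟩ ⟨Q, hQ⟩
  have hinj := (algebraMap F K).injective
  have hh' : map (algebraMap F K) h ≠ 0 := (map_ne_zero_iff _ (map_injective _ hinj)).2 hh
  have hQ0 : Q ≠ 0 := fun h0 => hh' (by rw [hQ, h0, mul_zero])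
  have hr0 : r ≠ 0 := fun h0 => hh' (by rw [hQ, h0, zero_mul])
  obtain ⟨m, hm⟩ := ne_zero_iff.1 hQ0
  obtain ⟨ψ, hψ⟩ : ∃ ψ : K →ₗ[F] F, ψ (Q.coeff m) ≠ 0 := by
    by_contra! h0
    exact hm ((Module.forall_dual_apply_eq_zero_iff F _).1 h0)
  -- A common factor r with cofactors P and Q gives Q g = P h over K, and the functional brings this
  -- relation down to F.
  have e : coeffwise ψ Q * g = coeffwise ψ P * h := by
    rw [← coeffwise_mul_map, ← coeffwise_mul_map, hP, hQ]
    congr 1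
    ring
  have hne : coeffwise ψ Q ≠ 0 := ne_zero_iff.2 ⟨m, by rwa [coeff_coeffwise]⟩
  have hdvd : h ∣ coeffwise ψ Q :=
    hgh.symm.dvd_of_dvd_mul_right (Dvd.intro_left _ e.symm)
  -- Now deg h ≤ deg Q, whereas deg h = deg r + deg Q, so r is constant.
  have h1 := (totalDegree_le_of_dvd_of_isDomain hdvd hne).trans (totalDegree_coeffwise_le ψ Q)
  have h2 : (map (algebraMap F K) h).totalDegree = h.totalDegree :=
    congrArg (fun s => s.sup fun m => m.sum fun _ e => e) (support_map_of_injective h hinj)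
  rw [hQ, totalDegree_mul_of_isDomain hr0 hQ0] at h2
  have h3 : r.totalDegree = 0 := by lia
  rw [totalDegree_eq_zero_iff_eq_C] at h3
  rw [h3]
  refine (isUnit_iff_ne_zero.2 fun h0 => hr0 ?_).map C
  rw [h3, h0, C_0]

end BaseChange

/-! ### Irreducible factors and multiplicities -/

section Factorization

open UniqueFactorizationMonoid

variable {K : Type u} [Field K] {σ : Type v}

theorem totalDegree_pos_of_irreducible {w : MvPolynomial σ K} (hw : Irreducible w) :
    0 < w.totalDegree := by
  refine Nat.pos_of_ne_zero fun h => hw.not_isUnit ?_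
  rw [isUnit_iff_totalDegree_of_isReduced]
  refine ⟨isUnit_iff_ne_zero.2 fun h0 => hw.ne_zero ?_, h⟩
  rw [totalDegree_eq_zero_iff_eq_C.1 h, h0, C_0]

theorem card_le_totalDegree_prod (s : Multiset (MvPolynomial σ K))
    (hs : ∀ w ∈ s, Irreducible w) : Multiset.card s ≤ s.prod.totalDegree := by
  induction s using Multiset.induction_on with
  | empty => simp
  | cons w s ih =>
    have h1 := ih fun v hv => hs v (Multiset.mem_cons_of_mem hv)
    have hw := hs w (Multiset.mem_cons_self w s)
    have h2 : s.prod ≠ 0 := by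
      refine Multiset.prod_ne_zero fun h0 => ?_
      exact (hs 0 (Multiset.mem_cons_of_mem h0)).ne_zero rfl
    rw [Multiset.card_cons, Multiset.prod_cons, totalDegree_mul_of_isDomain hw.ne_zero h2]
    have := totalDegree_pos_of_irreducible hw
    lia

/-- The factorization of `f` and of a factor `g` of exact multiplicity `k` into irreducibles. -/
theorem exists_factorization {f g h : MvPolynomial σ K} {k : ℕ} (hf : f ≠ 0) (hk : 0 < k)
    (hfgh : f = g ^ k * h) (hgh : IsRelPrime g h) :
    ∃ (s t : Finset (MvPolynomial σ K)) (m A : MvPolynomial σ K → ℕ) (c c' : K),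
      s ⊆ t ∧ (∀ w ∈ t, Irreducible w) ∧ (∀ v ∈ t, ∀ w ∈ t, v ≠ w → ¬ v ∣ w) ∧ c ≠ 0 ∧
      f = C c * ∏ w ∈ t, w ^ m w ∧ g = C c' * ∏ w ∈ s, w ^ A w ∧
      s.card ≤ f.totalDegree ∧
      ∀ w ∈ s, 0 < A w ∧ m w = k * A w ∧ m w ≤ f.totalDegree ∧ w.totalDegree ≤ f.totalDegree := by
  classical
  let _ : StrongNormalizationMonoid (MvPolynomial σ K) :=
    UniqueFactorizationMonoid.strongNormalizationMonoid
  have hg0 : g ≠ 0 := by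
    rintro rfl
    exact hf (by rw [hfgh, zero_pow hk.ne', zero_mul])
  have hh0 : h ≠ 0 := by
    rintro rfl
    exact hf (by rw [hfgh, mul_zero])
  have hnf : normalizedFactors f = k • normalizedFactors g + normalizedFactors h := by
    rw [hfgh, normalizedFactors_mul (pow_ne_zero _ hg0) hh0, normalizedFactors_pow]
  have key : ∀ P : MvPolynomial σ K, P ≠ 0 → ∃ c, c ≠ 0 ∧
      P = C c * ∏ w ∈ (normalizedFactors P).toFinset, w ^ (normalizedFactors P).count w := by
    intro P hP
    obtain ⟨r, hr⟩ := prod_normalizedFactors hP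
    obtain ⟨c, hc, hc'⟩ := isUnit_iff_eq_C_of_isReduced.1 r.isUnit
    refine ⟨c, hc.ne_zero, ?_⟩
    rw [← Finset.prod_multiset_count, ← hc', mul_comm, hr]
  have hcard : ∀ P : MvPolynomial σ K, P ≠ 0 →
      Multiset.card (normalizedFactors P) ≤ P.totalDegree := by
    intro P hP
    refine (card_le_totalDegree_prod _ fun w hw => irreducible_of_normalized_factor w hw).trans ?_
    exact totalDegree_le_of_dvd_of_isDomain (prod_normalizedFactors hP).dvd hP
  have hgf : g ∣ f := by
    rw [hfgh]
    exact (dvd_pow_self g hk.ne').mul_right h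
  obtain ⟨c, hc, hc'⟩ := key f hf
  obtain ⟨c', -, hg'⟩ := key g hg0
  have hsub : (normalizedFactors g).toFinset ⊆ (normalizedFactors f).toFinset := fun w hw => by
    rw [Multiset.mem_toFinset] at hw ⊢
    rw [hnf, Multiset.mem_add]
    exact Or.inl ((Multiset.mem_nsmul_of_ne_zero hk.ne').2 hw)
  refine ⟨_, _, _, _, c, c', hsub,
    fun w hw => irreducible_of_normalized_factor w (Multiset.mem_toFinset.1 hw),
    fun v hv w hw hvw hdvd => hvw ?_, hc, hc', hg', ?_, fun w hw => ?_⟩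
  · rw [Multiset.mem_toFinset] at hv hw
    have h1 : Associated v w := (irreducible_of_normalized_factor v hv).associated_of_dvd
      (irreducible_of_normalized_factor w hw) hdvd
    rw [← normalize_normalized_factor v hv, ← normalize_normalized_factor w hw]
    exact normalize_eq_normalize_iff_associated.2 h1
  · exact ((Multiset.toFinset_card_le _).trans (hcard g hg0)).trans
      (totalDegree_le_of_dvd_of_isDomain hgf hf)
  · have hw' := hsub hw
    rw [Multiset.mem_toFinset] at hw hw'
    refine ⟨Multiset.count_pos.2 hw, ?_, (Multiset.count_le_card _ _).trans (hcard f hf),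
      totalDegree_le_of_dvd_of_isDomain (dvd_of_mem_normalizedFactors hw') hf⟩
    -- An irreducible factor of g does not divide h, so its multiplicity in f comes from g^k alone.
    rw [hnf, Multiset.count_add, Multiset.count_nsmul, Nat.add_eq_left, Multiset.count_eq_zero]
    intro hwh
    exact (irreducible_of_normalized_factor w hw).not_isUnit
      (hgh (dvd_of_mem_normalizedFactors hw) (dvd_of_mem_normalizedFactors hwh))

end Factorization

/-! ### The factor as a product over roots -/

section GlobalFormula

/-- `g ^ p ^ l` is a product of root formulas up to an error of high order in `t`. -/
theorem exists_root_product {K : Type u} [Field K] [IsAlgClosed K] {p : ℕ} (hp : p.Prime)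
    [CharP K p] (η : ℕ → K) (hη : Function.Injective η) {σ : Type v} [Fintype σ] {d l e : ℕ}
    {f g h : MvPolynomial σ K} (hf : f ≠ 0) (hd : f.totalDegree ≤ d) (he : ¬ p ∣ e)
    (hfgh : f = g ^ (p ^ l * e) * h) (hgh : IsRelPrime g h) :
    ∃ (s : Finset (MvPolynomial σ K)) (Z : MvPolynomial σ K → Finset K) (A : MvPolynomial σ K → ℕ)
      (R : MvPolynomial σ K → K → RootData K) (κ : K) (x a : σ → K),
      s.card ≤ d ∧ (∀ w ∈ s, (Z w).card ≤ d ∧ A w ≤ d) ∧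
      ∀ (S : Type (max u v)) [CommRing S] [Algebra K S] (t : S) (y : σ → S),
        t ^ (d + 1) = 0 → (∀ j, t ∣ y j - algebraMap K S (x j)) →
        aeval y (g ^ p ^ l) = algebraMap K S κ * ∏ w ∈ s, ∏ β ∈ Z w, (R w β).formula d
          (fun i => aeval (fun j => y j + algebraMap K S (a j * (β + η i))) f) ^ A w := by
  classical
  have := Fact.mk hp
  have hl0 : 0 < p ^ l := pow_pos hp.pos l
  have he0 : 0 < e := Nat.pos_of_ne_zero fun h => he (h ▸ dvd_zero p)
  obtain ⟨s, T, m, A, c, c', hsT, hirr, hdvd, hc, hfT, hgs, hcard, hs⟩ :=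
    exists_factorization hf (Nat.mul_pos hl0 he0) hfgh hgh
  obtain ⟨a, x, ha, hsep⟩ := exists_generic_line p hp T hirr hdvd
  -- The multiplicity of w in g may itself be divisible by p. Its p-part is absorbed into the power
  -- of the root that the formula yields, and A' remains as an outer exponent.
  choose! v A' hA' hAv using fun w (hw : w ∈ s) =>
    Nat.exists_eq_pow_mul_and_not_dvd (hs w hw).1.ne' p hp.ne_one
  have hsep' : ∀ w ∈ T, (line x a w).Separable := fun w hw =>
    hsep.of_dvd (Finset.dvd_prod_of_mem _ hw)
  have hne : Nonempty (RootData K) := ⟨⟨0, 0, 0, 0⟩⟩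
  have hpl : ∀ w ∈ s, p ^ l * A w = p ^ (l + v w) * A' w := fun w hw => by
    rw [pow_add, mul_assoc, ← hAv w hw]
  have hroot : ∀ w ∈ s, ∀ β ∈ (line x a w).roots.toFinset, (line x a w).eval β = 0 :=
    fun w _ β hβ => (Polynomial.mem_roots'.1 (Multiset.mem_toFinset.1 hβ)).2
  have hR : ∀ w ∈ s, ∀ β ∈ (line x a w).roots.toFinset, ∃ R : RootData K,
      ∀ (S : Type (max u v)) [CommRing S] [Algebra K S] (t : S) (y : σ → S),
      t ^ (d + 1) = 0 → (∀ j, t ∣ y j - algebraMap K S (x j)) →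
      ∃ φ : S, IsNilpotent (φ - algebraMap K S β) ∧ (line y a w).eval φ = 0 ∧
        R.formula d (fun i => aeval (fun j => y j + algebraMap K S (a j * (β + η i))) f) =
          φ ^ p ^ (l + v w) := by
    intro w hw β hβ
    have hm : m w = p ^ (l + v w) * (e * A' w) := by
      rw [(hs w hw).2.1, mul_right_comm, hpl w hw]
      ring
    have heA : ¬ p ∣ e * A' w := hp.not_dvd_mul he (hA' w hw)
    have heA0 : 0 < e * A' w := Nat.pos_of_ne_zero fun h => heA (h ▸ dvd_zero p)
    have hle : p ^ (l + v w) ≤ d := by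
      refine (Nat.le_mul_of_pos_right _ heA0).trans ?_
      rw [← hm]
      exact (hs w hw).2.2.1.trans hd
    refine exists_rootData_line hp η hη hd heA hle
      (f' := C c * ∏ w' ∈ T.erase w, w' ^ m w') ?_ (hroot w hw β hβ) ?_ ?_
    · rw [← hm, hfT, ← Finset.mul_prod_erase T _ (hsT hw)]
      ring
    · obtain ⟨P, Q, hPQ⟩ := hsep' w (hsT hw)
      intro h0
      have := congrArg (Polynomial.eval β) hPQ
      simp [h0, hroot w hw β hβ] at this
    · rw [map_mul, line_C, map_prod, Polynomial.eval_mul, Polynomial.eval_prod]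
      refine mul_ne_zero (by simpa using hc) (Finset.prod_ne_zero_iff.2 fun w' hw' => ?_)
      rw [map_pow, Polynomial.eval_pow]
      refine pow_ne_zero _ fun h0 => ?_
      -- Separability makes w coprime to the other factors on the line, so none of them vanishes at
      -- β.
      have h1 : (line x a w * ∏ w' ∈ T.erase w, line x a w').Separable := by
        rwa [Finset.mul_prod_erase T _ (hsT hw)]
      obtain ⟨P, Q, hPQ⟩ := h1.isCoprime
      obtain ⟨Y, hY⟩ := Finset.dvd_prod_of_mem (fun w' => line x a w') hw'
      have := congrArg (Polynomial.eval β) hPQ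
      rw [hY] at this
      simp [h0, hroot w hw β hβ] at this
  choose! R hR using hR
  set lc := fun w : MvPolynomial σ K => eval a (homogeneousComponent w.totalDegree w) with hlc
  set Z := fun w : MvPolynomial σ K => (line x a w).roots.toFinset with hZ
  -- The constant collects the scalar of g, the top coefficients of the factors on the line and the
  -- signs of the roots.
  refine ⟨s, Z, A', R, c' ^ p ^ l * ∏ w ∈ s, (lc w ^ (p ^ l * A w) *
    ∏ β ∈ Z w, (-1) ^ (p ^ l * A w)), x, a, hcard.trans hd, fun w hw => ⟨?_, ?_⟩, ?_⟩
  · refine (Multiset.toFinset_card_le _).trans ((Polynomial.card_roots' _).trans ?_)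
    exact (line_degree x a le_rfl).1.trans ((hs w hw).2.2.2.trans hd)
  · refine le_trans ?_ ((hs w hw).2.2.1.trans hd)
    rw [(hs w hw).2.1, mul_right_comm, hpl w hw, mul_right_comm]
    exact Nat.le_mul_of_pos_left _ (Nat.mul_pos (pow_pos hp.pos _) he0)
  intro S _ _ t y ht hy
  choose! φ hφ1 hφ2 hφ3 using fun w hw β hβ => hR w hw β hβ S t y ht hy
  -- The value of w at y is read off at parameter 0 of the line through y.
  have hline : ∀ w ∈ s, aeval y w = algebraMap K S (lc w) * ∏ β ∈ Z w, -φ w β := by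
    intro w hw
    have h1 := line_eq_prod (y := y) a (ha w (hsT hw)) (hsep' w (hsT hw))
      (fun β hβ => ⟨hφ1 w hw β hβ, hφ2 w hw β hβ⟩)
    have h2 := congrArg (Polynomial.eval 0) h1
    rw [eval_line, Polynomial.eval_mul, Polynomial.eval_prod] at h2
    simpa using h2
  rw [hgs, map_pow, map_mul, map_prod, mul_pow, ← Finset.prod_pow, algHom_C, map_mul, map_pow,
    mul_assoc, map_prod, ← Finset.prod_mul_distrib]
  congr 1
  refine Finset.prod_congr rfl fun w hw => ?_
  rw [map_pow, ← pow_mul, mul_comm (A w), hline w hw, mul_pow, map_mul, map_pow, mul_assoc,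
    map_prod, ← Finset.prod_mul_distrib, ← Finset.prod_pow]
  congr 1
  refine Finset.prod_congr rfl fun β hβ => ?_
  rw [hφ3 w hw β hβ, ← pow_mul, ← hpl w hw, neg_pow]
  simp

end GlobalFormula

/-! ### Size, depth and interpolation in t -/

section Assembly

/-- All sizes are kept as powers of one number N; a layer of fan-in at most N^i raises the exponent
by i + 1. -/
theorem mul_succ_le_pow {N k s : ℕ} (hN : 2 ≤ N) {i j : ℕ} (hk : k ≤ N ^ i) (hs : s ≤ N ^ j) :
    k * (s + 1) ≤ N ^ (i + j + 1) := by
  have h1 : s + 1 ≤ N ^ j * N := by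
    have := Nat.one_le_pow j N (by lia)
    nlinarith
  calc k * (s + 1) ≤ N ^ i * (N ^ j * N) := Nat.mul_le_mul hk h1
    _ = N ^ (i + j + 1) := by ring

variable {K : Type u} [Field K] {σ : Type v}

theorem RootData.compBy_formula {b : Prop} {N d D : ℕ} (hN : 4 ≤ N) (hd : 2 * (d + 1) ≤ N)
    (R : RootData K) {v : ℕ → MvPolynomial σ K} (hv : ∀ i, CompBy b N D (v i)) :
    CompBy b (N ^ 13) (D + 6) (R.formula d v) := by
  have h2 : 2 ≤ N := by lia
  have hN1 : N ≤ N ^ 1 := (pow_one N).ge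
  have e1 : ∀ k, CompBy b (N ^ 5) (D + 3) (∑ i ∈ Finset.range (d + 1), C (R.b k i) * v i) :=
    fun k => (CompBy.sum (Finset.range (d + 1)) (k := N) (by rw [Finset.card_range]; lia) _
      fun i _ => hv i).mono ((mul_succ_le_pow h2 hN1 hN1).trans
        (Nat.pow_le_pow_right (by lia) (by lia))) (by lia)
  have e2 : ∀ k j, j ≤ d → CompBy b (N ^ 5) (D + 3) ((C (R.c k) - v k) ^ j) := by
    intro k j hj
    have h3 := CompBy.lin 1 (-1) (CompBy.of_const (b := b) (R.c k) N D) (hv k)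
    have h4 : C (1 : K) * C (R.c k) + C (-1) * v k = C (R.c k) - v k := by
      simp [sub_eq_add_neg]
    rw [h4] at h3
    refine (CompBy.pow (k := N) (by lia) h3).mono ?_ (by lia)
    refine mul_succ_le_pow h2 hN1 (j := 3) ?_
    exact mul_succ_le_pow h2 (i := 1) (by lia) hN1
  have e3 : ∀ k j, j ≤ d → CompBy b (N ^ 7) (D + 4)
      ((∑ i ∈ Finset.range (d + 1), C (R.b k i) * v i) * (C (R.c k) - v k) ^ j) :=
    fun k j hj => ((e1 k).mul (e2 k j hj)).mono
      (mul_succ_le_pow h2 (i := 1) (by lia) le_rfl) le_rfl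
  have e4 := CompBy.sum (b := b) (s := N ^ 7) (D := D + 4)
    (Finset.range (d + 1) ×ˢ Finset.range (3 * d + d * d + 1)) (k := N ^ 3)
    (by
      rw [Finset.card_product, Finset.card_range, Finset.card_range]
      calc (d + 1) * (3 * d + d * d + 1) ≤ N * (N * N) :=
            Nat.mul_le_mul (by lia) (le_trans (by nlinarith) (Nat.mul_le_mul hd hd))
        _ = N ^ 3 := by ring)
    (fun z => R.w z.1 z.2)
    (P := fun z => (∑ i ∈ Finset.range (d + 1), C (R.b z.2 i) * v i) * (C (R.c z.2) - v z.2) ^ z.1)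
    fun z hz => e3 _ _ (Nat.lt_succ_iff.1 (Finset.mem_range.1 (Finset.mem_product.1 hz).1))
  rw [Finset.sum_product] at e4
  have e5 := CompBy.lin 1 1 (CompBy.of_const (b := b) R.r (N ^ 11) (D + 4 + 1))
    (e4.mono (mul_succ_le_pow h2 le_rfl le_rfl) le_rfl)
  refine (cast (congrArg _ ?_) e5).mono (mul_succ_le_pow h2 (i := 1) (by lia) le_rfl) le_rfl
  simp only [RootData.formula, C_1, one_mul, algebraMap_eq, smul_eq_C_mul]

theorem natDegree_aeval_le {d : ℕ} {f : MvPolynomial σ K} (hd : f.totalDegree ≤ d)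
    {y : σ → Polynomial (MvPolynomial σ K)} (hy : ∀ j, (y j).natDegree ≤ 1) :
    (aeval y f).natDegree ≤ d := by
  have h := aeval_natDegree_le (map (algebraMap K (MvPolynomial σ K)) f)
    ((Finset.sup_mono (support_map_subset _ _)).trans hd) y hy
  rwa [aeval_map_algebraMap, mul_one] at h

theorem RootData.natDegree_formula_le (R : RootData K) {d : ℕ}
    {v : ℕ → Polynomial (MvPolynomial σ K)} (hv : ∀ i, (v i).natDegree ≤ d) :
    (R.formula d v).natDegree ≤ d + d * d := by
  refine (Polynomial.natDegree_add_le_of_le (m := 0) ?_ ?_).trans_eq (max_eq_right (Nat.zero_le _))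
  · exact (Polynomial.natDegree_C _).le
  refine Polynomial.natDegree_sum_le_of_forall_le _ _ fun j hj => ?_
  refine Polynomial.natDegree_sum_le_of_forall_le _ _ fun k _ => ?_
  refine (Polynomial.natDegree_smul_le _ _).trans (Polynomial.natDegree_mul_le_of_le ?_ ?_)
  · exact Polynomial.natDegree_sum_le_of_forall_le _ _ fun i _ =>
      (Polynomial.natDegree_smul_le _ _).trans (hv i)
  · refine (Polynomial.natDegree_pow_le_of_le (m := d) j ?_).trans
      (Nat.mul_le_mul_right d (Nat.lt_succ_iff.1 (Finset.mem_range.1 hj)))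
    exact (Polynomial.natDegree_sub_le_of_le (m := 0) (Polynomial.natDegree_C _).le (hv k)).trans_eq
      (max_eq_right (Nat.zero_le _))

/-- A circuit for the factor, given circuits for all rescaled translates of the polynomial. -/
theorem compBy_factor [IsAlgClosed K] [Fintype σ] {p : ℕ} (hp : p.Prime) [CharP K p] {d l e : ℕ} {f g h : MvPolynomial σ K}
    (hf : f ≠ 0) (hd : f.totalDegree ≤ d) (he : ¬ p ∣ e) (hfgh : f = g ^ (p ^ l * e) * h)
    (hgh : IsRelPrime g h) {b : Prop} {N D : ℕ} (hN : 4 ≤ N) (hdN : 2 * (d + 1) ≤ N)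
    (hv : ∀ (c : σ → K) (τ : K), CompBy b N D (aeval (fun i => C (c i) + C τ * X i) f)) :
    CompBy b (N ^ 26) (D + 10) (g ^ p ^ l) := by
  have hη := (Infinite.natEmbedding K).injective
  set η := Infinite.natEmbedding K
  obtain ⟨s, Z, A, R, κ, x, a, hs, hZA, key⟩ := exists_root_product hp η hη hf hd he hfgh hgh
  -- The outer polynomial variable plays the role of t: the point moves from x at t = 0 to the
  -- generic point X at t = 1.
  set y : σ → Polynomial (MvPolynomial σ K) := fun j =>
    Polynomial.C (C (x j)) + Polynomial.X * Polynomial.C (X j - C (x j)) with hy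
  have hy1 : ∀ j, (y j).natDegree ≤ 1 := fun j => by
    rw [hy]; simp only; compute_degree
  let w : K → ℕ → Polynomial (MvPolynomial σ K) := fun β i =>
    aeval (fun j => y j + algebraMap K _ (a j * (β + η i))) f
  set B : Polynomial (MvPolynomial σ K) := algebraMap K _ κ *
    ∏ v ∈ s, ∏ β ∈ Z v, (R v β).formula d (w β) ^ A v with hB
  have map_B : ∀ {T : Type (max u v)} [CommRing T] [Algebra K T]
      (ψ : Polynomial (MvPolynomial σ K) →ₐ[K] T), ψ B = algebraMap K T κ *
      ∏ v ∈ s, ∏ β ∈ Z v, (R v β).formula d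
        (fun i => aeval (fun j => ψ (y j) + algebraMap K T (a j * (β + η i))) f) ^ A v := by
    intro T _ _ ψ
    simp only [hB, w, map_mul, map_prod, map_pow, RootData.map_formula, AlgHom.commutes,
      comp_aeval_apply, map_add]
  have hψ : ∀ {T : Type (max u v)} [CommRing T] [Algebra K T]
      (ψ : Polynomial (MvPolynomial σ K) →ₐ[K] T), ψ (Polynomial.X ^ (d + 1)) = 0 →
      ψ (aeval y (g ^ p ^ l)) = ψ B := by
    intro T _ _ ψ hX
    rw [map_B ψ, comp_aeval_apply]
    refine key T (ψ Polynomial.X) (fun j => ψ (y j)) (by rw [← map_pow, hX]) fun j => ?_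
    refine Dvd.intro (ψ (Polynomial.C (X j - C (x j)))) ?_
    rw [← ψ.commutes (x j), ← map_sub, ← map_mul]
    congr 1
    exact (add_sub_cancel_left _ _).symm
  -- The root product is exact only where t^(d+1) = 0, so it is applied in the quotient ring.
  have hdvd : Polynomial.X ^ (d + 1) ∣ aeval y (g ^ p ^ l) - B := by
    set I := Ideal.span {(Polynomial.X ^ (d + 1) : Polynomial (MvPolynomial σ K))} with hI
    have h1 := hψ (T := Polynomial (MvPolynomial σ K) ⧸ I) (Ideal.Quotient.mkₐ K I)
      (Ideal.Quotient.eq_zero_iff_mem.2 (Ideal.mem_span_singleton_self _))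
    exact Ideal.mem_span_singleton.1 (Ideal.Quotient.eq.1 h1)
  have hcoeff : ∀ k ≤ d, (aeval y (g ^ p ^ l)).coeff k = B.coeff k := fun k hk =>
    sub_eq_zero.1 (by
      rw [← Polynomial.coeff_sub]
      exact Polynomial.X_pow_dvd_iff.1 hdvd k (Nat.lt_succ_of_le hk))
  have he0 : 0 < e := Nat.pos_of_ne_zero fun h => he (h ▸ dvd_zero p)
  have hgf : g ^ p ^ l ∣ f := by
    rw [hfgh, pow_mul]
    exact (dvd_pow_self _ he0.ne').mul_right _
  have hAdeg : (aeval y (g ^ p ^ l)).natDegree ≤ d :=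
    natDegree_aeval_le ((totalDegree_le_of_dvd_of_isDomain hgf hf).trans hd) hy1
  have hBdeg : B.natDegree ≤ d + d * (d * (d * (d + d * d))) := by
    have hw : ∀ β i, (w β i).natDegree ≤ d := fun β i => natDegree_aeval_le hd fun j =>
      Polynomial.natDegree_add_le_of_degree_le (hy1 j)
        ((Polynomial.natDegree_C _).le.trans (Nat.zero_le 1))
    have h1 : ∀ v ∈ s, ∀ β, ((R v β).formula d (w β) ^ A v).natDegree ≤ d * (d + d * d) :=
      fun v hv β => (Polynomial.natDegree_pow_le_of_le _
        ((R v β).natDegree_formula_le (hw β))).trans (Nat.mul_le_mul_right _ (hZA v hv).2)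
    have h2 : ∀ v ∈ s, (∏ β ∈ Z v, (R v β).formula d (w β) ^ A v).natDegree ≤
        d * (d * (d + d * d)) := fun v hv =>
      (Polynomial.natDegree_prod_le _ _).trans ((Finset.sum_le_card_nsmul _ _ _
        fun β _ => h1 v hv β).trans (Nat.mul_le_mul_right _ (hZA v hv).1))
    have h3 := (Polynomial.natDegree_prod_le s _).trans
      ((Finset.sum_le_card_nsmul _ _ _ h2).trans (Nat.mul_le_mul_right _ hs))
    exact Polynomial.natDegree_mul_le_of_le
      ((Polynomial.natDegree_C _).le.trans (Nat.zero_le d)) h3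
  -- This functional cuts off at degree d in t and then sets t = 1. The number of nodes follows the
  -- larger degree bound of B.
  obtain ⟨c, hc⟩ := Polynomial.exists_sum_eval_eq.{u, max u v} η hη (d + d * (d * (d * (d + d * d))))
    fun k => if k ≤ d then 1 else 0
  have hsum : g ^ p ^ l = ∑ i ∈ Finset.range (d + d * (d * (d * (d + d * d))) + 1),
      c i • B.eval (algebraMap K _ (η i)) := by
    rw [hc _ B hBdeg]
    have h1 : (aeval y (g ^ p ^ l)).eval 1 = g ^ p ^ l := by
      have h2 := comp_aeval_apply (φ := (Polynomial.aeval (1 : MvPolynomial σ K)).restrictScalars K)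
        y (g ^ p ^ l)
      have h3 : ∀ j, ((Polynomial.aeval (1 : MvPolynomial σ K)).restrictScalars K) (y j) = X j := by
        intro j
        simp [hy]
      simp only [h3, aeval_X_left_apply] at h2
      simpa using h2
    rw [← h1, Polynomial.eval_eq_sum_range' (Nat.lt_succ_of_le hAdeg)]
    have h4 : Finset.range d.succ ⊆ Finset.range (d + d * (d * (d * (d + d * d))) + 1) :=
      Finset.range_subset_range.2 (by lia)
    refine Eq.trans ?_ (Finset.sum_subset h4 fun k _ hk => ?_)
    · refine Finset.sum_congr rfl fun k hk => ?_
      have hk' := Nat.lt_succ_iff.1 (Finset.mem_range.1 hk)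
      rw [if_pos hk', hcoeff k hk']
      simp
    · rw [if_neg fun h => hk (Finset.mem_range.2 (Nat.lt_succ_of_le h)), zero_smul]
  have h2N : 2 ≤ N := by lia
  have hN1 : N ≤ N ^ 1 := (pow_one N).ge
  have hdN' : d ≤ N ^ 1 := by lia
  have hval : ∀ τ : K, CompBy b (N ^ 19) (D + 9) (∏ v ∈ s, ∏ β ∈ Z v, (R v β).formula d
      (fun i => aeval (fun j => C (x j - τ * x j + a j * (β + η i)) + C τ * X j) f) ^ A v) := by
    intro τ
    refine (CompBy.prod s (hs.trans hdN') (s := N ^ 17) (D := D + 8) fun v hvs => ?_).mono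
      (mul_succ_le_pow h2N le_rfl le_rfl) le_rfl
    refine (CompBy.prod (Z v) ((hZA v hvs).1.trans hdN') (s := N ^ 15) (D := D + 7)
      fun β _ => ?_).mono (mul_succ_le_pow h2N le_rfl le_rfl) le_rfl
    exact (CompBy.pow ((hZA v hvs).2.trans hdN') ((R v β).compBy_formula hN hdN
      fun i => hv _ τ)).mono (mul_succ_le_pow h2N le_rfl le_rfl) le_rfl
  -- At t = τ every argument of f is a constant plus τ times a variable, exactly the inputs for
  -- which `hv` gives circuits.
  have heval : ∀ τ : K, B.eval (algebraMap K _ τ) = C κ * ∏ v ∈ s, ∏ β ∈ Z v, (R v β).formula d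
      (fun i => aeval (fun j => C (x j - τ * x j + a j * (β + η i)) + C τ * X j) f) ^ A v := by
    intro τ
    have h1 := map_B ((Polynomial.aeval (algebraMap K (MvPolynomial σ K) τ)).restrictScalars K)
    have h2 : ∀ β i j, ((Polynomial.aeval (algebraMap K (MvPolynomial σ K) τ)).restrictScalars K)
        (y j) + algebraMap K _ (a j * (β + η i)) =
        C (x j - τ * x j + a j * (β + η i)) + C τ * X j := by
      intro β i j
      simp [hy, algebraMap_eq]
      ring
    simp only [h2] at h1
    simpa [algebraMap_eq] using h1
  have hfin := CompBy.sum (b := b) (s := N ^ 19) (D := D + 9)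
    (Finset.range (d + d * (d * (d * (d + d * d))) + 1)) (k := N ^ 6)
    (by
      rw [Finset.card_range]
      have h1 : d + 1 ≤ N := by lia
      calc d + d * (d * (d * (d + d * d))) + 1 ≤ (d + 1) ^ 5 := by ring_nf; nlinarith
        _ ≤ N ^ 5 := Nat.pow_le_pow_left h1 5
        _ ≤ N ^ 6 := Nat.pow_le_pow_right (by lia) (by lia))
    (fun i => c i * κ) fun i _ => hval (η i)
  refine (cast (congrArg _ ?_) hfin).mono (mul_succ_le_pow h2N le_rfl le_rfl) le_rfl
  rw [hsum]
  refine Finset.sum_congr rfl fun i _ => ?_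
  rw [heval, smul_eq_C_mul, C_mul, mul_assoc]

end Assembly

/-! ### Descent of the hypotheses and conclusion -/

section Main

theorem affineHom_eq_aeval_map {F K : Type u} {σ : Type v} [Field F] [Field K] [Algebra F K]
    (c : σ → K) (t : K) (f : MvPolynomial σ F) :
    affineHom c t f = aeval (fun i => C (c i) + C t * X i) (map (algebraMap F K) f) := by
  rw [aeval_def, eval₂_map]
  rfl

/-- Since g^k h = 0, either g = 0, or h = 0 and coprimality with 0 makes g a unit. -/
theorem exists_map_pow_eq_C {F K : Type*} {σ : Type*} [Field F] [Field K] [Algebra F K]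
    {g : MvPolynomial σ F} {k m : ℕ} (hm : 0 < m) (h : HasMultiplicity g 0 k) :
    ∃ r : K, map (algebraMap F K) (g ^ m) = C r := by
  obtain ⟨h, h0, hgh⟩ := h
  rcases mul_eq_zero.1 h0.symm with h1 | rfl
  · exact ⟨0, by rw [eq_zero_of_pow_eq_zero h1, zero_pow hm.ne', map_zero, C_0]⟩
  · obtain ⟨r, -, rfl⟩ := isUnit_iff_eq_C_of_isReduced.1 (isRelPrime_zero_right.1 hgh)
    exact ⟨algebraMap F K r ^ m, by simp⟩

theorem compBy_of_hasMultiplicity {p : ℕ} (hp : p.Prime) {F : Type u} [Field F] [CharP F p]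
    {σ : Type v} [Fintype σ] {f g : MvPolynomial σ F} {l e : ℕ}
    (hm : HasMultiplicity g f (p ^ l * e)) (he : Nat.gcd p e = 1) {b : Prop} (A : AlgCircuit F σ)
    (hA : A.Computes f) (hb : b → A.IsFormula) :
    CompBy b ((4 * (A.size + f.totalDegree + 1)) ^ 26) (A.depth + 11)
      (map (algebraMap F (AlgebraicClosure F)) (g ^ p ^ l)) := by
  have hK : CharP (AlgebraicClosure F) p :=
    charP_of_injective_algebraMap (algebraMap F (AlgebraicClosure F)).injective p
  by_cases hf : f = 0
  · subst hf
    obtain ⟨r, hr⟩ := exists_map_pow_eq_C (K := AlgebraicClosure F) (pow_pos hp.pos l) hm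
    rw [hr]
    exact CompBy.of_const _ _ _
  · have he' : ¬ p ∣ e := fun h => hp.ne_one (by rw [← he, Nat.gcd_eq_left h])
    obtain ⟨h, hfgh, hgh⟩ := hm
    have hh : h ≠ 0 := by
      rintro rfl
      exact hf (by rw [hfgh, mul_zero])
    have hinj := map_injective (σ := σ) _ (algebraMap F (AlgebraicClosure F)).injective
    rw [map_pow]
    -- N is 4 (size + degree + 1), which bounds both the size 3 (size + 1) after substitution and 2
    -- (degree + 1). The substitution costs depth 1 and the factor construction 10.
    refine compBy_factor hp ((map_ne_zero_iff _ hinj).2 hf)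
      (Finset.sup_mono (support_map_subset _ f)) he'
      (h := map (algebraMap F (AlgebraicClosure F)) h) ?_ (hgh.map_algebraMap hh) (by lia)
      (d := f.totalDegree) (by lia) fun c τ => ?_
    · rw [hfgh, map_mul, map_pow]
    · rw [← affineHom_eq_aeval_map]
      exact (A.compBy_affineHom c τ hA hb).mono (by lia) le_rfl

end Main

theorem theorem1p2 :
    ∃ c : ℕ, ∀ (p : ℕ) (_ : p.Prime) (F : Type u) [Field F] [Finite F] [CharP F p]
      (n : ℕ) (f g : MvPolynomial (Fin n) F) (l e : ℕ),
      HasMultiplicity g f (p ^ l * e) → Nat.gcd p e = 1 →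
      (∀ A : AlgCircuit F (Fin n), A.Computes f →
        ∃ B : AlgCircuit (AlgebraicClosure F) (Fin n),
          B.Computes (MvPolynomial.map (algebraMap F (AlgebraicClosure F)) (g ^ p ^ l)) ∧
          B.size ≤ c * (A.size + f.totalDegree + n + 1) ^ c ∧
          B.depth ≤ A.depth + c) ∧
      (∀ A : AlgCircuit F (Fin n), A.IsFormula → A.Computes f →
        ∃ B : AlgCircuit (AlgebraicClosure F) (Fin n),
          B.IsFormula ∧
          B.Computes (MvPolynomial.map (algebraMap F (AlgebraicClosure F)) (g ^ p ^ l)) ∧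
          B.size ≤ c * (A.size + f.totalDegree + n + 1) ^ c) := by
  obtain ⟨c, hc1, hc2⟩ : ∃ c, 4 ^ 26 ≤ c ∧ 26 ≤ c := ⟨4 ^ 26, le_rfl, by norm_num⟩
  refine ⟨c, fun p hp F _ _ _ n f g l e hm he => ?_⟩
  have hsize : ∀ A : AlgCircuit F (Fin n), (4 * (A.size + f.totalDegree + 1)) ^ 26 ≤
      c * (A.size + f.totalDegree + n + 1) ^ c := fun A => by
    rw [mul_pow]
    have h : A.size + f.totalDegree + 1 ≤ A.size + f.totalDegree + n + 1 := by lia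
    exact Nat.mul_le_mul hc1 ((Nat.pow_le_pow_left h 26).trans
      (Nat.pow_le_pow_right (Nat.succ_pos _) hc2))
  refine ⟨fun A hA => ?_, fun A hF hA => ?_⟩
  · obtain ⟨B, h1, h2, h3, -⟩ := compBy_of_hasMultiplicity hp hm he (b := False) A hA False.elim
    exact ⟨B, h1, h2.trans (hsize A), h3.trans (Nat.add_le_add_left (by lia) _)⟩
  · obtain ⟨B, h1, h2, -, h4⟩ := compBy_of_hasMultiplicity hp hm he (b := True) A hA fun _ => hF
    exact ⟨B, (h4 trivial).1, h1, h2.trans (hsize A)⟩
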